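/- Let $n\ge 1$, $0<s<\min(1,n/2)$, and let $\Omega\subset\mathbb R^n$ be an open set which is bounded in one direction, i.e. contained in the image under a rigid motion of a cylinder $\mathbb R^{n-k}\times\omega$ with $0<k\le n$ and $\omega\subset\mathbb R^k$ bounded and open; put $\Omega_e=\mathbb R^n\setminus\overline\Omega$. For $t\in\mathbb R$, $1\le p\le\infty$ let $H^{t,p}(\mathbb R^n)$ be the space of tempered distributions $u$ with $\langle D\rangle^t u:=(1-\Delta)^{t/2}u\in L^p(\mathbb R^n)$. Let $H^s(\mathbb R^n)$ denote the real-valued functions in $H^{s,2}(\mathbb R^n)$, with norm $\|u\|_{H^s}=\|\langle D\rangle^s u\|_{L^2}$, let $\widetilde H^s(\Omega)$ be the closure of $C_c^\infty(\Omega)$ in $H^s(\mathbb R^n)$, and let $X=H^s(\mathbb R^n)/\widetilde H^s(\Omega)$ with the quotient norm. For $u\in H^s(\mathbb R^n)$ let $$\nabla^s u(x,y)=\sqrt{\tfrac{C_{n,s}}{2}}\,\frac{u(x)-u(y)}{|x-y|^{n/2+s+1}}(x-y),\qquad C_{n,s}=\frac{4^s\,\Gamma(n/2+s)}{\pi^{n/2}|\Gamma(-s)|},$$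 and for a positive $\gamma\in L^\infty(\mathbb R^n)$ let $$B_\gamma(u,v)=\int_{\mathbb R^{2n}}\gamma^{1/2}(x)\gamma^{1/2}(y)\,\nabla^s u(x,y)\cdot\nabla^s v(x,y)\,dx\,dy .$$ A function $u\in H^s(\mathbb R^n)$ is a weak solution of the fractional conductivity equation in $\Omega$ with exterior value $f\in H^s(\mathbb R^n)$ if $B_\gamma(u,\phi)=0$ for all $\phi\in\widetilde H^s(\Omega)$ and $u-f\in\widetilde H^s(\Omega)$. Let $\gamma_0>0$ and let $\gamma_1,\gamma_2\in L^\infty(\mathbb R^n)$ be real functions with $\gamma_i\ge\gamma_0$ a.e. and $m_i:=\gamma_i^{1/2}-1\in H^{2s,\frac n{2s}}(\mathbb R^n)$, $i=1,2$. Let $W\subset\Omega_e$ be a nonempty open set such that $\gamma_1,\gamma_2$ are continuous on $W$. Then for $i=1,2$ every exterior value $f\in H^s(\mathbb R^n)$ has a unique weak solution $u_f$ for $\gamma_i$, the exterior Dirichlet-to-Neumann map $\Lambda_{\gamma_i}\colon X\to X^*$, $\langle\Lambda_{\gamma_i}f,g\rangle=B_{\gamma_i}(u_f,g)$, is a well-defined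 bounded linear map, and $$\|\gamma_1-\gamma_2\|_{L^\infty(W)}\le 2^s\,\|\Lambda_{\gamma_1}-\Lambda_{\gamma_2}\|_{X\to X^*}.$$ -/

import Mathlib

open MeasureTheory TemperedDistribution Set
open scoped SchwartzMap ENNReal ContDiff

noncomputable section

namespace FracCond

/-- Euclidean space `ℝⁿ`. -/
abbrev Rn (n : ℕ) : Type := EuclideanSpace ℝ (Fin n)

/-! ### Bessel potential spaces -/

/-- The symbol of `⟨D⟩^s`. With the Fourier transform `∫ u(x) exp(-i x·ξ) dx` it is
`⟨ξ⟩^s = (1 + |ξ|²)^{s/2}`; Mathlib's transform is `∫ u(x) exp(-2πi x·ξ) dx`, so that in Mathlib's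
frequency variable the same operator `(1 - Δ)^{s/2}` has the symbol `(1 + |2πξ|²)^{s/2}`. -/
def besselSymbol (n : ℕ) (s : ℝ) (ξ : Rn n) : ℝ :=
  (1 + ‖(2 * Real.pi) • ξ‖ ^ 2) ^ (s / 2)

/-- The Bessel potential `⟨D⟩^s = (1 - Δ)^{s/2}` on complex valued tempered distributions. -/
def besselD (n : ℕ) (s : ℝ) : 𝓢'(Rn n, ℂ) →L[ℂ] 𝓢'(Rn n, ℂ) :=
  fourierMultiplierCLM ℂ (fun ξ => ((besselSymbol n s ξ : ℝ) : ℂ))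

/-- The tempered distribution `T` is (given by integration against) the function `f`. -/
def IsFunction {n : ℕ} (T : 𝓢'(Rn n, ℂ)) (f : Rn n → ℂ) : Prop :=
  ∀ φ : 𝓢(Rn n, ℂ), Integrable (fun x => φ x * f x) ∧ T φ = ∫ x, φ x * f x

/-- The real function `f` on `ℝⁿ` belongs to the Bessel potential space `H^{s,p}(ℝⁿ)`:
`f` is a tempered distribution with `⟨D⟩^s f ∈ L^p(ℝⁿ)`. -/
def MemBessel {n : ℕ} (s : ℝ) (p : ℝ≥0∞) (f : Rn n → ℝ) : Prop :=
  ∃ T : 𝓢'(Rn n, ℂ), IsFunction T (fun x => (f x : ℂ)) ∧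
    ∃ g : Rn n → ℂ, MemLp g p volume ∧ IsFunction (besselD n s T) g

lemma hasTemperateGrowth_besselSymbol (n : ℕ) (s : ℝ) :
    (fun ξ : Rn n => ((besselSymbol n s ξ : ℝ) : ℂ)).HasTemperateGrowth := by
  have h := (Function.hasTemperateGrowth_one_add_norm_sq_rpow (Rn n) (s / 2)).comp
    (((2 * Real.pi) • ContinuousLinearMap.id ℝ (Rn n)).hasTemperateGrowth)
  exact (Complex.ofRealCLM.hasTemperateGrowth).comp h

lemma besselD_injective (n : ℕ) (s : ℝ) : Function.Injective (besselD n s) := by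
  have key : ∀ T, besselD n (-s) (besselD n s T) = T := by
    intro T
    unfold besselD
    rw [fourierMultiplierCLM_fourierMultiplierCLM_apply
      (hasTemperateGrowth_besselSymbol n _) (hasTemperateGrowth_besselSymbol n _)]
    have : ((fun ξ : Rn n => ((besselSymbol n (-s) ξ : ℝ) : ℂ)) *
        (fun ξ : Rn n => ((besselSymbol n s ξ : ℝ) : ℂ))) = fun _ => 1 := by
      ext ξ
      have h : (0 : ℝ) < 1 + ‖(2 * Real.pi) • ξ‖ ^ 2 := by positivity
      simp only [Pi.mul_apply, besselSymbol]
      rw [← Complex.ofReal_mul, ← Real.rpow_add h]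
      simp [neg_div]
    rw [mul_comm] at this
    rw [this]
    simp
  exact Function.LeftInverse.injective key

lemma IsFunction.unique_left {n : ℕ} {T T' : 𝓢'(Rn n, ℂ)} {f : Rn n → ℂ}
    (h : IsFunction T f) (h' : IsFunction T' f) : T = T' := by
  ext φ
  rw [(h φ).2, (h' φ).2]

lemma IsFunction.congr {n : ℕ} {T : 𝓢'(Rn n, ℂ)} {f g : Rn n → ℂ}
    (h : IsFunction T f) (hfg : f =ᵐ[volume] g) : IsFunction T g := by
  intro φ
  have e : (fun x => φ x * f x) =ᵐ[volume] fun x => φ x * g x := by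
    filter_upwards [hfg] with x hx
    rw [hx]
  exact ⟨(h φ).1.congr e, (h φ).2.trans (integral_congr_ae e)⟩

lemma IsFunction.add {n : ℕ} {T T' : 𝓢'(Rn n, ℂ)} {f f' : Rn n → ℂ}
    (h : IsFunction T f) (h' : IsFunction T' f') : IsFunction (T + T') (f + f') := by
  intro φ
  have e : (fun x => φ x * (f + f') x) = fun x => φ x * f x + φ x * f' x := by
    ext x; simp [mul_add]
  rw [e]
  refine ⟨(h φ).1.add (h' φ).1, ?_⟩
  rw [integral_add (h φ).1 (h' φ).1, ← (h φ).2, ← (h' φ).2]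
  rfl

lemma IsFunction.smul {n : ℕ} {T : 𝓢'(Rn n, ℂ)} {f : Rn n → ℂ} (c : ℂ)
    (h : IsFunction T f) : IsFunction (c • T) (c • f) := by
  intro φ
  have e : (fun x => φ x * (c • f) x) = fun x => c * (φ x * f x) := by
    ext x; simp; ring
  rw [e]
  refine ⟨(h φ).1.const_mul c, ?_⟩
  rw [integral_const_mul, ← (h φ).2]
  rfl

lemma IsFunction.zero (n : ℕ) : IsFunction (0 : 𝓢'(Rn n, ℂ)) 0 := by
  intro φ
  simp only [Pi.zero_apply, mul_zero, integral_zero]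
  exact ⟨integrable_zero _ _ _, rfl⟩

lemma isFunction_Lp {n : ℕ} (g : Lp ℂ 2 (volume : Measure (Rn n))) :
    IsFunction (g : 𝓢'(Rn n, ℂ)) g := by
  intro φ
  refine ⟨?_, ?_⟩
  · exact MemLp.integrable_mul (φ.memLp 2 volume) (Lp.memLp g)
  · rw [Lp.toTemperedDistribution_apply]
    simp [smul_eq_mul]

lemma IsFunction.Lp_unique {n : ℕ} {T : 𝓢'(Rn n, ℂ)} {g h : Lp ℂ 2 (volume : Measure (Rn n))}
    (hg : IsFunction T g) (hh : IsFunction T h) : g = h := by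
  have e : (g : 𝓢'(Rn n, ℂ)) = (h : 𝓢'(Rn n, ℂ)) :=
    ((isFunction_Lp g).unique_left hg).trans (hh.unique_left (isFunction_Lp h))
  have hk := Lp.ker_toTemperedDistributionCLM_eq_bot (F := ℂ)
    (μ := (volume : Measure (Rn n))) (p := 2)
  exact LinearMap.ker_eq_bot.mp hk e

/-! ### The real Hilbert space `H^s(ℝⁿ)`, `s ≥ 0` -/

lemma coe_add_ae {n : ℕ} (u v : Lp ℝ 2 (volume : Measure (Rn n))) :
    ((fun x => ((u x : ℝ) : ℂ)) + fun x => ((v x : ℝ) : ℂ)) =ᵐ[volume]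
      fun x => (((u + v : Lp ℝ 2 (volume : Measure (Rn n))) x : ℝ) : ℂ) := by
  filter_upwards [Lp.coeFn_add u v] with x hx
  rw [hx]
  simp

lemma coe_smul_ae {n : ℕ} (c : ℝ) (u : Lp ℝ 2 (volume : Measure (Rn n))) :
    ((c : ℂ) • fun x => ((u x : ℝ) : ℂ)) =ᵐ[volume]
      fun x => (((c • u : Lp ℝ 2 (volume : Measure (Rn n))) x : ℝ) : ℂ) := by
  filter_upwards [Lp.coeFn_smul c u] with x hx
  rw [hx]
  simp

lemma coe_zero_ae (n : ℕ) :
    (0 : Rn n → ℂ) =ᵐ[volume]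
      fun x => (((0 : Lp ℝ 2 (volume : Measure (Rn n))) x : ℝ) : ℂ) := by
  filter_upwards [Lp.coeFn_zero ℝ 2 (volume : Measure (Rn n))] with x hx
  rw [hx]
  simp

/-- The real functions in `H^s(ℝⁿ) = H^{s,2}(ℝⁿ)`, as a subspace of `L²(ℝⁿ)`
(for `s ≥ 0` one has `H^s ⊆ L²`). -/
def sobolevSubmodule (n : ℕ) (s : ℝ) : Submodule ℝ (Lp ℝ 2 (volume : Measure (Rn n))) where
  carrier := {u | MemBessel s 2 u}
  add_mem' := by
    rintro u v ⟨T, hT, g, hg, hTg⟩ ⟨T', hT', g', hg', hTg'⟩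
    refine ⟨T + T', (hT.add hT').congr (coe_add_ae u v), g + g', hg.add hg', ?_⟩
    rw [map_add]
    exact hTg.add hTg'
  zero_mem' := by
    refine ⟨0, (IsFunction.zero n).congr (coe_zero_ae n), 0, MemLp.zero, ?_⟩
    rw [map_zero]
    exact IsFunction.zero n
  smul_mem' := by
    rintro c u ⟨T, hT, g, hg, hTg⟩
    refine ⟨(c : ℂ) • T, (hT.smul c).congr (coe_smul_ae c u), (c : ℂ) • g, hg.const_smul _, ?_⟩
    rw [map_smul]
    exact hTg.smul c

/-- The space `H^s(ℝⁿ)` of real functions. It carries the norm `‖⟨D⟩^s u‖_{L²}` given below, not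
the norm of `L²`. -/
def Hs (n : ℕ) (s : ℝ) : Type := sobolevSubmodule n s

instance (n : ℕ) (s : ℝ) : AddCommGroup (Hs n s) :=
  inferInstanceAs (AddCommGroup (sobolevSubmodule n s))

instance (n : ℕ) (s : ℝ) : Module ℝ (Hs n s) :=
  inferInstanceAs (Module ℝ (sobolevSubmodule n s))

/-- The inclusion `H^s(ℝⁿ) → L²(ℝⁿ)`. -/
def Hs.toL2 (n : ℕ) (s : ℝ) : Hs n s →ₗ[ℝ] Lp ℝ 2 (volume : Measure (Rn n)) :=
  (sobolevSubmodule n s).subtype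

/-- Elements of `H^s(ℝⁿ)` are regarded as functions (defined up to null sets). -/
instance (n : ℕ) (s : ℝ) : CoeFun (Hs n s) (fun _ => Rn n → ℝ) := ⟨fun u => Hs.toL2 n s u⟩

lemma Hs.exists_bessel {n : ℕ} {s : ℝ} (u : Hs n s) :
    ∃ G : Lp ℂ 2 (volume : Measure (Rn n)), ∃ T : 𝓢'(Rn n, ℂ),
      IsFunction T (fun x => ((u x : ℝ) : ℂ)) ∧ IsFunction (besselD n s T) G := by
  obtain ⟨T, hT, g, hg, hTg⟩ : MemBessel s 2 (u : Rn n → ℝ) := u.2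
  exact ⟨hg.toLp g, T, hT, hTg.congr hg.coeFn_toLp.symm⟩

/-- `⟨D⟩^s u` as an element of `L²(ℝⁿ)`, for `u ∈ H^s(ℝⁿ)`. -/
def Hs.bessel {n : ℕ} {s : ℝ} (u : Hs n s) : Lp ℂ 2 (volume : Measure (Rn n)) :=
  (Hs.exists_bessel u).choose

lemma Hs.bessel_eq_iff {n : ℕ} {s : ℝ} (u : Hs n s) (G : Lp ℂ 2 (volume : Measure (Rn n))) :
    u.bessel = G ↔ ∃ T : 𝓢'(Rn n, ℂ),
      IsFunction T (fun x => ((u x : ℝ) : ℂ)) ∧ IsFunction (besselD n s T) G := by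
  obtain ⟨T, hT, hTG⟩ := (Hs.exists_bessel u).choose_spec
  constructor
  · rintro rfl
    exact ⟨T, hT, hTG⟩
  · rintro ⟨T', hT', hTG'⟩
    obtain rfl := hT.unique_left hT'
    exact hTG.Lp_unique hTG'

/-- The linear map `⟨D⟩^s : H^s(ℝⁿ) → L²(ℝⁿ)`. -/
def Hs.besselMap (n : ℕ) (s : ℝ) : Hs n s →ₗ[ℝ] Lp ℂ 2 (volume : Measure (Rn n)) where
  toFun := Hs.bessel
  map_add' u v := by
    obtain ⟨T, hT, hG⟩ := (Hs.bessel_eq_iff u _).1 rfl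
    obtain ⟨T', hT', hG'⟩ := (Hs.bessel_eq_iff v _).1 rfl
    refine (Hs.bessel_eq_iff _ _).2 ⟨T + T', (hT.add hT').congr ?_, ?_⟩
    · rw [map_add]
      exact coe_add_ae _ _
    · rw [map_add]
      exact (hG.add hG').congr (Lp.coeFn_add _ _).symm
  map_smul' c u := by
    obtain ⟨T, hT, hG⟩ := (Hs.bessel_eq_iff u _).1 rfl
    refine (Hs.bessel_eq_iff _ _).2 ⟨(c : ℂ) • T, (hT.smul c).congr ?_, ?_⟩
    · rw [map_smul]
      exact coe_smul_ae _ _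
    · rw [map_smul]
      refine (hG.smul c).congr ?_
      filter_upwards [Lp.coeFn_smul c u.bessel] with x hx
      simp [hx]

lemma Hs.besselMap_injective (n : ℕ) (s : ℝ) : Function.Injective (Hs.besselMap n s) := by
  rw [← LinearMap.ker_eq_bot, LinearMap.ker_eq_bot']
  intro u hu
  obtain ⟨T, hT, hG⟩ := (Hs.bessel_eq_iff u 0).1 hu
  have h0 : besselD n s T = 0 :=
    (hG.congr (Lp.coeFn_zero ℂ 2 (volume : Measure (Rn n)))).unique_left (IsFunction.zero n)
  have hT0 : T = 0 := besselD_injective n s (by rw [h0, map_zero])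
  subst hT0
  have hm : MemLp (fun x => ((u x : ℝ) : ℂ)) 2 (volume : Measure (Rn n)) :=
    (Lp.memLp (Hs.toL2 n s u)).ofReal
  have h1 : hm.toLp _ = 0 :=
    (hT.congr hm.coeFn_toLp.symm).Lp_unique
      ((IsFunction.zero n).congr (Lp.coeFn_zero ℂ 2 (volume : Measure (Rn n))).symm)
  have h2 : Hs.toL2 n s u = 0 := by
    rw [Lp.eq_zero_iff_ae_eq_zero]
    have h3 := hm.coeFn_toLp
    rw [h1] at h3
    filter_upwards [h3, Lp.coeFn_zero ℂ 2 (volume : Measure (Rn n))] with x hx hx'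
    rw [hx'] at hx
    simpa using hx.symm
  exact Subtype.ext h2

/-- The norm `‖u‖_{H^s} = ‖⟨D⟩^s u‖_{L²}`. -/
instance (n : ℕ) (s : ℝ) : NormedAddCommGroup (Hs n s) :=
  NormedAddCommGroup.induced (Hs n s) (Lp ℂ 2 (volume : Measure (Rn n)))
    (Hs.besselMap n s) (Hs.besselMap_injective n s)

instance (n : ℕ) (s : ℝ) : NormedSpace ℝ (Hs n s) :=
  NormedSpace.induced ℝ (Hs n s) (Lp ℂ 2 (volume : Measure (Rn n))) (Hs.besselMap n s)

lemma Hs.norm_def {n : ℕ} {s : ℝ} (u : Hs n s) : ‖u‖ = ‖u.bessel‖ := rfl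

/-- The elements of `H^s(ℝⁿ)` that are test functions in `C_c^∞(Ω)`. -/
def testSubmodule {n : ℕ} (s : ℝ) (Ω : Set (Rn n)) : Submodule ℝ (Hs n s) where
  carrier := {u | ∃ φ : Rn n → ℝ, ContDiff ℝ ∞ φ ∧ HasCompactSupport φ ∧ tsupport φ ⊆ Ω ∧
    (u : Rn n → ℝ) =ᵐ[volume] φ}
  add_mem' := by
    rintro u v ⟨φ, h1, h2, h3, h4⟩ ⟨ψ, k1, k2, k3, k4⟩
    refine ⟨φ + ψ, h1.add k1, h2.add k2, (tsupport_add φ ψ).trans (union_subset h3 k3), ?_⟩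
    rw [map_add]
    exact (Lp.coeFn_add _ _).trans (h4.add k4)
  zero_mem' := by
    refine ⟨0, contDiff_const, HasCompactSupport.zero, by simp [tsupport], ?_⟩
    rw [map_zero]
    exact Lp.coeFn_zero _ _ _
  smul_mem' := by
    rintro c u ⟨φ, h1, h2, h3, h4⟩
    refine ⟨c • φ, h1.const_smul c, h2.smul_left (f := fun _ => c),
      (tsupport_smul_subset_right (fun _ => c) φ).trans h3, ?_⟩
    rw [map_smul]
    exact (Lp.coeFn_smul _ _).trans (h4.const_smul c)

/-- `H̃^s(Ω)`, the closure of `C_c^∞(Ω)` in `H^s(ℝⁿ)`. -/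
abbrev HsTilde {n : ℕ} (s : ℝ) (Ω : Set (Rn n)) : Submodule ℝ (Hs n s) :=
  (testSubmodule s Ω).topologicalClosure

instance {n : ℕ} (s : ℝ) (Ω : Set (Rn n)) : IsClosed (HsTilde s Ω : Set (Hs n s)) :=
  (testSubmodule s Ω).isClosed_topologicalClosure

/-- The space of exterior values `X = H^s(ℝⁿ) / H̃^s(Ω)` with the quotient norm. -/
def ExteriorSpace {n : ℕ} (s : ℝ) (Ω : Set (Rn n)) : Type := Hs n s ⧸ HsTilde s Ω

instance {n : ℕ} (s : ℝ) (Ω : Set (Rn n)) : NormedAddCommGroup (ExteriorSpace s Ω) :=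
  inferInstanceAs (NormedAddCommGroup (Hs n s ⧸ HsTilde s Ω))

instance {n : ℕ} (s : ℝ) (Ω : Set (Rn n)) : NormedSpace ℝ (ExteriorSpace s Ω) :=
  inferInstanceAs (NormedSpace ℝ (Hs n s ⧸ HsTilde s Ω))

/-- The quotient map `H^s(ℝⁿ) → X`. -/
def exteriorMk {n : ℕ} (s : ℝ) (Ω : Set (Rn n)) : Hs n s →ₗ[ℝ] ExteriorSpace s Ω :=
  (HsTilde s Ω).mkQ

lemma exteriorMk_surjective {n : ℕ} (s : ℝ) (Ω : Set (Rn n)) :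
    Function.Surjective (exteriorMk s Ω) :=
  (HsTilde s Ω).mkQ_surjective

/-! ### The fractional conductivity equation -/

/-- The constant `C_{n,s} = 4^s Γ(n/2 + s) / (π^{n/2} |Γ(-s)|)`. -/
def fracConst (n : ℕ) (s : ℝ) : ℝ :=
  4 ^ s * Real.Gamma (n / 2 + s) / (Real.pi ^ ((n : ℝ) / 2) * |Real.Gamma (-s)|)

/-- The fractional gradient
`∇^s u(x,y) = √(C_{n,s}/2) (u(x) - u(y)) |x - y|^{-(n/2+s+1)} (x - y)`. -/
def fracGrad {n : ℕ} (s : ℝ) (u : Rn n → ℝ) (x y : Rn n) : Rn n :=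
  (√(fracConst n s / 2) * ((u x - u y) / ‖x - y‖ ^ ((n : ℝ) / 2 + s + 1))) • (x - y)

/-- The bilinear form `B_γ(u,v) = ∫_{ℝ²ⁿ} Θ_γ ∇^s u · ∇^s v dx dy`, with
`Θ_γ(x,y) = γ^{1/2}(x) γ^{1/2}(y) 1_{n×n}`. -/
def bilin {n : ℕ} {s : ℝ} (γ : Rn n → ℝ) (u v : Hs n s) : ℝ :=
  ∫ p : Rn n × Rn n,
    inner ℝ ((√(γ p.1) * √(γ p.2)) • fracGrad s u p.1 p.2) (fracGrad s v p.1 p.2)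

/-- `u` is a weak solution of `div_s(Θ_γ · ∇^s u) = 0` in `Ω`, `u = f` in the exterior of `Ω`. -/
def IsWeakSolution {n : ℕ} {s : ℝ} (Ω : Set (Rn n)) (γ : Rn n → ℝ) (f u : Hs n s) : Prop :=
  (∀ φ ∈ HsTilde s Ω, bilin γ u φ = 0) ∧ u - f ∈ HsTilde s Ω

/-- `Λ` is the exterior Dirichlet-to-Neumann map of the conductivity `γ`: the exterior value
problem has a unique weak solution `u_f` for every exterior value `f`, and `Λ` is the bounded linear
map `X → X*` with `⟨Λ f, g⟩ = B_γ(u_f, g)`. -/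
def IsDNMap {n : ℕ} {s : ℝ} (Ω : Set (Rn n)) (γ : Rn n → ℝ)
    (Λ : ExteriorSpace s Ω →L[ℝ] (ExteriorSpace s Ω →L[ℝ] ℝ)) : Prop :=
  ∀ f : Hs n s, (∃! u : Hs n s, IsWeakSolution Ω γ f u) ∧
    ∀ u : Hs n s, IsWeakSolution Ω γ f u → ∀ g : Hs n s,
      Λ (exteriorMk s Ω f) (exteriorMk s Ω g) = bilin γ u g

lemma IsDNMap.unique {n : ℕ} {s : ℝ} {Ω : Set (Rn n)} {γ : Rn n → ℝ}
    {Λ Λ' : ExteriorSpace s Ω →L[ℝ] (ExteriorSpace s Ω →L[ℝ] ℝ)}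
    (h : IsDNMap Ω γ Λ) (h' : IsDNMap Ω γ Λ') : Λ = Λ' := by
  ext f g
  obtain ⟨f, rfl⟩ := exteriorMk_surjective s Ω f
  obtain ⟨g, rfl⟩ := exteriorMk_surjective s Ω g
  obtain ⟨u, hu, -⟩ := (h f).1
  rw [(h f).2 u hu g, (h' f).2 u hu g]

open Classical in
/-- The exterior Dirichlet-to-Neumann map `Λ_γ : X → X*` (by convention `0` if there is none;
there is at most one). -/
def dnMap {n : ℕ} (s : ℝ) (Ω : Set (Rn n)) (γ : Rn n → ℝ) :
    ExteriorSpace s Ω →L[ℝ] (ExteriorSpace s Ω →L[ℝ] ℝ) :=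
  if h : ∃ Λ, IsDNMap (s := s) Ω γ Λ then h.choose else 0

/-- `Ω` is bounded in one direction: up to a rigid motion it is contained in a cylindrical domain
`ℝ^j × S` with `S ⊆ ℝ^k` bounded and open, `j + k = n` and `k > 0`. -/
def BoundedInOneDirection {n : ℕ} (Ω : Set (Rn n)) : Prop :=
  ∃ (j k : ℕ) (h : j + k = n) (S : Set (Rn k)) (A : Rn n ≃ᵃⁱ[ℝ] Rn n),
    0 < k ∧ IsOpen S ∧ Bornology.IsBounded S ∧
      Ω ⊆ A '' {x : Rn n | WithLp.toLp 2 (fun i : Fin k => x (Fin.cast h (Fin.natAdd j i))) ∈ S}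

end FracCond

end

noncomputable section

namespace FracCond

/-! ### The constant of the Gagliardo seminorm -/

/-! The estimate is pointwise: at every point `x₀` of `W` where both conductivities are at least
`γ₀`, `|γ₁(x₀) - γ₂(x₀)| ≤ ‖Λ₁ - Λ₂‖`, even without the factor `2^s`. The Dirichlet-to-Neumann forms
are tested on functions `φ` concentrated near `x₀`. Write `[φ]` for the `L²` norm of the scalar
fractional gradient `fracDiff`, and `u = φ + w` for the solution with exterior value `φ`, so `w ∈
H̃^s(Ω)` and `⟨Λφ, φ⟩ = B(φ, φ) + B(w, φ)`.

Cross term: `φ` and `w` live at positive distance `δ`, so `B(w, φ)` sees only pairs with `|x - y| ≥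
δ`. There the kernel is integrable and the gradient of `φ` is controlled by `‖φ‖_{L²}`
(`exists_tail`, `exists_abs_dnMap_sub_le`). Diagonal term: by continuity `B(φ, φ)` is `γ(x₀)[φ]²` up
to `ε[φ]² + C‖φ‖²_{L²}` (`exists_abs_conductivityForm_sub_le`). For bumps on small balls `‖φ‖²_{L²}
≤ η[φ]²` (`exists_concentrated`), so all `L²` errors are negligible. Finally `‖φ‖²_{H^s} ≤ ‖φ‖²_{L²}
+ [φ]²` (`Hs.norm_sq_le`), and dividing by `[φ]²` gives the bound with constant one.

Behind this is the Fourier identity `[u] = ‖(-Δ)^{s/2}u‖_{L²}` (`lintegral_fracDiff_eq_fourier`),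
for which `C_{n,s}` is normalized, together with a Poincaré inequality obtained from translations
(`Hs.poincare`): if `u` lives on `A` and `A + z` misses `A`, then `‖u(· + z) - u‖ ≥ ‖u‖` in `L²`.
Integrating over such `z` against the kernel bounds `‖u‖_{L²}` by `[u]`. On `Ω`, with translations
across its bounded direction, this gives coercivity of `B_γ`, hence well-posedness by Lax–Milgram;
on a ball of radius `ρ` it gives `[φ]² ≥ cρ^{-2s}‖φ‖²_{L²}`, hence concentration. -/

/-- The kernel `(C_{n,s} / 2) |z|^{-(n + 2s)}` of the Gagliardo seminorm. -/
def fracKernel (n : ℕ) (s : ℝ) (z : Rn n) : ℝ :=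
  fracConst n s / 2 * ‖z‖ ^ (-((n : ℝ) + 2 * s))

/-- This is the total mass of the Gaussian minus its Fourier transform at `ξ`. -/
lemma lintegral_one_sub_cos_mul_gaussian {n : ℕ} {τ : ℝ} (hτ : 0 < τ) (ξ : Rn n) :
    ∫⁻ z : Rn n, ENNReal.ofReal
        ((1 - Real.cos (2 * Real.pi * inner ℝ z ξ)) * Real.exp (-(‖z‖ ^ 2 / τ))) =
      ENNReal.ofReal ((Real.pi * τ) ^ ((n : ℝ) / 2) *
        (1 - Real.exp (-(Real.pi ^ 2 * ‖ξ‖ ^ 2 * τ)))) := by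
  have hb : 0 < ((τ⁻¹ : ℝ) : ℂ).re := by simpa using hτ
  have hpi := Real.pi_pos
  -- `c = 0` gives the mass and `c = 1` the transform at `ξ`.
  have key (c : ℝ) :
      Integrable (fun z : Rn n =>
        Real.cos (2 * Real.pi * c * inner ℝ z ξ) * Real.exp (-(‖z‖ ^ 2 / τ))) ∧
      ∫ z : Rn n, Real.cos (2 * Real.pi * c * inner ℝ z ξ) * Real.exp (-(‖z‖ ^ 2 / τ)) =
        (Real.pi * τ) ^ ((n : ℝ) / 2) * Real.exp (-(Real.pi ^ 2 * c ^ 2 * ‖ξ‖ ^ 2 * τ)) := by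
    have h := GaussianFourier.integral_cexp_neg_mul_sq_norm_add hb
      (((2 * Real.pi * c : ℝ) : ℂ) * Complex.I) ξ
    have hR : ((Real.pi : ℂ) / ((τ⁻¹ : ℝ) : ℂ)) ^ ((Module.finrank ℝ (Rn n) : ℂ) / 2) *
        Complex.exp ((((2 * Real.pi * c : ℝ) : ℂ) * Complex.I) ^ 2 * (‖ξ‖ : ℂ) ^ 2 /
          (4 * ((τ⁻¹ : ℝ) : ℂ))) =
        (((Real.pi * τ) ^ ((n : ℝ) / 2) *
          Real.exp (-(Real.pi ^ 2 * c ^ 2 * ‖ξ‖ ^ 2 * τ)) : ℝ) : ℂ) := by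
      rw [Complex.ofReal_mul ((Real.pi * τ) ^ ((n : ℝ) / 2)), Complex.ofReal_cpow (by positivity),
        Complex.ofReal_exp]
      congr 2
      · push_cast
        rw [div_inv_eq_mul]
      · simp
      · rw [mul_pow, Complex.I_sq]
        push_cast
        field_simp
        ring
    rw [hR] at h
    have hint : Integrable (fun v : Rn n => Complex.exp (-((τ⁻¹ : ℝ) : ℂ) * (‖v‖ : ℂ) ^ 2 +
        ((2 * Real.pi * c : ℝ) : ℂ) * Complex.I * (inner ℝ ξ v : ℝ))) := by
      -- A Bochner integral of a nonintegrable function is `0`, so the nonzero closed form already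
      -- proves integrability.
      refine Integrable.of_integral_ne_zero ?_
      rw [h]
      norm_cast
      positivity
    have hre : ∀ v : Rn n, (Complex.exp (-((τ⁻¹ : ℝ) : ℂ) * (‖v‖ : ℂ) ^ 2 +
        ((2 * Real.pi * c : ℝ) : ℂ) * Complex.I * (inner ℝ ξ v : ℝ))).re =
        Real.cos (2 * Real.pi * c * inner ℝ v ξ) * Real.exp (-(‖v‖ ^ 2 / τ)) := by
      intro v
      have e1 : -((τ⁻¹ : ℝ) : ℂ) * (‖v‖ : ℂ) ^ 2 +
        ((2 * Real.pi * c : ℝ) : ℂ) * Complex.I * (inner ℝ ξ v : ℝ) =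
        ((-(‖v‖ ^ 2 / τ) : ℝ) : ℂ) + ((2 * Real.pi * c * inner ℝ v ξ : ℝ) : ℂ) * Complex.I := by
        rw [real_inner_comm]
        push_cast
        ring
      rw [e1, Complex.exp_add, ← Complex.ofReal_exp, Complex.re_ofReal_mul,
        Complex.exp_ofReal_mul_I_re, mul_comm]
    constructor
    · exact (hint.re).congr (Filter.Eventually.of_forall hre)
    · have h2 := integral_re hint
      have h3 : ∀ z : ℂ, RCLike.re z = z.re := fun _ => rfl
      simp only [h3, hre] at h2
      rw [h2, h, Complex.ofReal_re]
  obtain ⟨i0, e0⟩ := key 0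
  obtain ⟨i1, e1⟩ := key 1
  simp only [mul_zero, zero_mul, Real.cos_zero, one_mul, mul_one, one_pow, ne_eq,
    OfNat.ofNat_ne_zero, not_false_eq_true, zero_pow, neg_zero, Real.exp_zero] at i0 e0 i1 e1
  rw [← ofReal_integral_eq_lintegral_ofReal]
  · congr 1
    simp only [sub_mul, one_mul]
    rw [integral_sub i0 i1, e0, e1]
    ring
  · simp only [sub_mul, one_mul]
    exact i0.sub i1
  · refine Filter.Eventually.of_forall fun z => ?_
    have := Real.cos_le_one (2 * Real.pi * inner ℝ z ξ)
    have : 0 ≤ 1 - Real.cos (2 * Real.pi * inner ℝ z ξ) := by linarith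
    simp only [Pi.zero_apply]
    positivity

lemma lintegral_rpow_mul_exp_neg_mul {a r : ℝ} (ha : 0 < a) (hr : 0 < r) :
    ∫⁻ t in Ioi (0 : ℝ), ENNReal.ofReal (t ^ (a - 1) * Real.exp (-(r * t))) =
      ENNReal.ofReal ((1 / r) ^ a * Real.Gamma a) := by
  have h := Real.integral_rpow_mul_exp_neg_mul_Ioi ha hr
  have hG := Real.Gamma_pos_of_pos ha
  rw [← h, ofReal_integral_eq_lintegral_ofReal]
  · refine Integrable.of_integral_ne_zero ?_
    rw [h]
    positivity
  · filter_upwards [ae_restrict_mem measurableSet_Ioi] with t (ht : 0 < t)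
    simp only [Pi.zero_apply]
    positivity

/-- Euler's integral after `t ↦ 1/t`. With `b = |z|²` it writes a negative power of `|z|` as a
superposition of Gaussians in `z`. -/
lemma lintegral_rpow_mul_exp_neg_div {q b : ℝ} (hq : 0 < q) (hb : 0 < b) :
    ∫⁻ t in Ioi (0 : ℝ), ENNReal.ofReal (t ^ (-q - 1) * Real.exp (-(b / t))) =
      ENNReal.ofReal (b ^ (-q) * Real.Gamma q) := by
  have h := Real.integral_rpow_mul_exp_neg_mul_Ioi hq hb
  have hG := Real.Gamma_pos_of_pos hq
  have h1 : ∫ t in Ioi (0 : ℝ), t ^ (-q - 1) * Real.exp (-(b / t)) = b ^ (-q) * Real.Gamma q := by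
    rw [← integral_comp_rpow_Ioi _ (p := -1) (by norm_num)] at h
    rw [one_div, Real.inv_rpow hb.le, ← Real.rpow_neg hb.le] at h
    rw [← h]
    refine setIntegral_congr_fun measurableSet_Ioi fun t (ht : 0 < t) => ?_
    simp only [abs_neg, abs_one, one_mul, smul_eq_mul]
    rw [← mul_assoc, Real.rpow_neg_one, ← Real.rpow_neg_one, ← Real.rpow_mul ht.le,
      ← Real.rpow_add ht, Real.rpow_neg_one, div_eq_mul_inv]
    congr 2
    ring
  rw [← h1, ofReal_integral_eq_lintegral_ofReal]
  · refine Integrable.of_integral_ne_zero ?_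
    rw [h1]
    positivity
  · filter_upwards [ae_restrict_mem measurableSet_Ioi] with t (ht : 0 < t)
    simp only [Pi.zero_apply]
    positivity

/-- The fundamental theorem of calculus in the exponent; the extra `r`-integral lets Tonelli reduce
the `τ`-integral of the next lemma to a Gamma integral. -/
lemma ofReal_one_sub_exp_eq_lintegral {a τ : ℝ} (s : ℝ) (ha : 0 ≤ a) (hτ : 0 < τ) :
    ENNReal.ofReal (τ ^ (-s - 1) * (1 - Real.exp (-(a * τ)))) =
      ∫⁻ r in Ioc 0 a, ENNReal.ofReal (τ ^ ((1 - s) - 1) * Real.exp (-(r * τ))) := by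
  have hd : ∀ r ∈ uIcc 0 a, HasDerivAt (fun r => -(τ⁻¹ * Real.exp (-(r * τ))))
      (Real.exp (-(r * τ))) r := by
    intro r _
    have h1 : HasDerivAt (fun r : ℝ => -(r * τ)) (-(1 * τ)) r :=
      ((hasDerivAt_id r).mul_const τ).neg
    have h2 := (h1.exp.const_mul τ⁻¹).neg
    refine h2.congr_deriv ?_
    linear_combination (Real.exp (-(r * τ))) * inv_mul_cancel₀ hτ.ne'
  have hc : Continuous fun r : ℝ => Real.exp (-(r * τ)) := by fun_prop
  have hI := intervalIntegral.integral_eq_sub_of_hasDerivAt hd (hc.intervalIntegrable _ _)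
  rw [intervalIntegral.integral_of_le ha] at hI
  rw [← ofReal_integral_eq_lintegral_ofReal]
  · rw [integral_const_mul, hI]
    congr 1
    have e : τ ^ (-s - 1) = τ ^ (1 - s - 1) * τ⁻¹ := by
      rw [← Real.rpow_neg_one τ, ← Real.rpow_add hτ]
      congr 1
      ring
    rw [e]
    simp
    ring
  · exact ((hc.intervalIntegrable 0 a).1).const_mul _
  · refine Filter.Eventually.of_forall fun r => ?_
    simp only [Pi.zero_apply]
    positivity

lemma lintegral_rpow_mul_one_sub_exp {a s : ℝ} (ha : 0 ≤ a) (hs0 : 0 < s) (hs1 : s < 1) :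
    ∫⁻ τ in Ioi (0 : ℝ), ENNReal.ofReal (τ ^ (-s - 1) * (1 - Real.exp (-(a * τ)))) =
      ENNReal.ofReal (Real.Gamma (1 - s) * (a ^ s / s)) := by
  have hG := Real.Gamma_pos_of_pos (sub_pos.2 hs1)
  calc _ = ∫⁻ τ in Ioi (0 : ℝ), ∫⁻ r in Ioc 0 a,
          ENNReal.ofReal (τ ^ ((1 - s) - 1) * Real.exp (-(r * τ))) :=
        setLIntegral_congr_fun measurableSet_Ioi fun τ hτ =>
          ofReal_one_sub_exp_eq_lintegral s ha hτ
    _ = ∫⁻ r in Ioc 0 a, ∫⁻ τ in Ioi (0 : ℝ),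
          ENNReal.ofReal (τ ^ ((1 - s) - 1) * Real.exp (-(r * τ))) := by
        refine lintegral_lintegral_swap (Measurable.aemeasurable ?_)
        unfold Function.uncurry
        fun_prop
    _ = ∫⁻ r in Ioc 0 a, ENNReal.ofReal (Real.Gamma (1 - s) * r ^ (s - 1)) := by
        refine setLIntegral_congr_fun measurableSet_Ioc fun r hr => ?_
        rw [lintegral_rpow_mul_exp_neg_mul (sub_pos.2 hs1) hr.1, one_div,
          Real.inv_rpow hr.1.le, ← Real.rpow_neg hr.1.le, mul_comm]
        congr 3
        ring
    _ = _ := by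
        rw [← ofReal_integral_eq_lintegral_ofReal]
        · rw [integral_const_mul, ← intervalIntegral.integral_of_le ha,
            integral_rpow (Or.inl (by linarith))]
          simp [hs0.ne']
        · exact ((intervalIntegral.intervalIntegrable_rpow' (a := 0) (b := a)
            (by linarith : -1 < s - 1)).1).const_mul _
        · filter_upwards [ae_restrict_mem measurableSet_Ioc] with r hr
          have := hr.1
          simp only [Pi.zero_apply]
          positivity

/-- Subordination: replace the power of `|z|` by its Gaussian superposition, exchange integrals,
evaluate the Gaussian integral in `z`, and then the remaining one-dimensional integral in `t`. -/
lemma lintegral_norm_rpow_mul_one_sub_cos {n : ℕ} {s : ℝ} (hs0 : 0 < s) (hs1 : s < 1) (ξ : Rn n) :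
    ENNReal.ofReal (Real.Gamma (n / 2 + s)) * ∫⁻ z : Rn n, ENNReal.ofReal
        (‖z‖ ^ (-((n : ℝ) + 2 * s)) * (1 - Real.cos (2 * Real.pi * inner ℝ z ξ))) =
      ENNReal.ofReal (Real.pi ^ ((n : ℝ) / 2) *
        (Real.Gamma (1 - s) * ((Real.pi ^ 2 * ‖ξ‖ ^ 2) ^ s / s))) := by
  have hpi := Real.pi_pos
  have hq : 0 < (n : ℝ) / 2 + s := by positivity
  have hcos : ∀ z : Rn n, 0 ≤ 1 - Real.cos (2 * Real.pi * inner ℝ z ξ) := fun z => by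
    linarith [Real.cos_le_one (2 * Real.pi * inner ℝ z ξ)]
  calc _ = ∫⁻ z : Rn n, ∫⁻ t in Ioi (0 : ℝ), ENNReal.ofReal (t ^ (-((n : ℝ) / 2 + s) - 1) *
          ((1 - Real.cos (2 * Real.pi * inner ℝ z ξ)) * Real.exp (-(‖z‖ ^ 2 / t)))) := by
        rw [← lintegral_const_mul' _ _ ENNReal.ofReal_ne_top]
        refine lintegral_congr fun z => ?_
        -- At `z = 0` the factor `1 - cos` vanishes, so the value of the singular power there is
        -- irrelevant.
        rcases eq_or_ne z 0 with rfl | hz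
        · simp
        have hz' : 0 < ‖z‖ := norm_pos_iff.2 hz
        have h := lintegral_rpow_mul_exp_neg_div hq (pow_pos hz' 2)
        have e : (‖z‖ ^ 2) ^ (-((n : ℝ) / 2 + s)) = ‖z‖ ^ (-((n : ℝ) + 2 * s)) := by
          rw [← Real.rpow_natCast, ← Real.rpow_mul hz'.le]
          congr 1
          push_cast
          ring
        rw [e] at h
        rw [← ENNReal.ofReal_mul (Real.Gamma_pos_of_pos hq).le, ← mul_assoc,
          mul_comm (Real.Gamma _), mul_comm (_ * _), ENNReal.ofReal_mul (hcos z), ← h,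
          ← lintegral_const_mul' _ _ ENNReal.ofReal_ne_top]
        refine lintegral_congr fun t => ?_
        rw [← ENNReal.ofReal_mul (hcos z)]
        congr 1
        ring
    _ = ∫⁻ t in Ioi (0 : ℝ), ∫⁻ z : Rn n, ENNReal.ofReal (t ^ (-((n : ℝ) / 2 + s) - 1) *
          ((1 - Real.cos (2 * Real.pi * inner ℝ z ξ)) * Real.exp (-(‖z‖ ^ 2 / t)))) := by
        refine lintegral_lintegral_swap (Measurable.aemeasurable ?_)
        unfold Function.uncurry
        fun_prop
    _ = ∫⁻ t in Ioi (0 : ℝ), ENNReal.ofReal (Real.pi ^ ((n : ℝ) / 2)) *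
          ENNReal.ofReal (t ^ (-s - 1) * (1 - Real.exp (-(Real.pi ^ 2 * ‖ξ‖ ^ 2 * t)))) := by
        refine setLIntegral_congr_fun measurableSet_Ioi fun t (ht : 0 < t) => ?_
        have h0 : 0 ≤ t ^ (-((n : ℝ) / 2 + s) - 1) := by positivity
        simp only [ENNReal.ofReal_mul h0]
        rw [lintegral_const_mul' _ _ ENNReal.ofReal_ne_top,
          lintegral_one_sub_cos_mul_gaussian ht, ← ENNReal.ofReal_mul h0,
          ← ENNReal.ofReal_mul (by positivity), Real.mul_rpow hpi.le ht.le]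
        congr 1
        have e : t ^ (-s - 1) = t ^ (-((n : ℝ) / 2 + s) - 1) * t ^ ((n : ℝ) / 2) := by
          rw [← Real.rpow_add ht]
          congr 1
          ring
        rw [e]
        ring
    _ = _ := by
        rw [lintegral_const_mul' _ _ ENNReal.ofReal_ne_top,
          lintegral_rpow_mul_one_sub_exp (by positivity) hs0 hs1,
          ← ENNReal.ofReal_mul (by positivity)]

lemma abs_Gamma_neg {s : ℝ} (hs0 : 0 < s) (hs1 : s < 1) :
    |Real.Gamma (-s)| = Real.Gamma (1 - s) / s := by
  have h := Real.Gamma_add_one (neg_ne_zero.2 hs0.ne')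
  have hG := Real.Gamma_pos_of_pos (sub_pos.2 hs1)
  rw [neg_add_eq_sub] at h
  rw [h, abs_of_neg]
  · field_simp
  · by_contra hc
    push Not at hc
    nlinarith

lemma fracConst_pos {n : ℕ} {s : ℝ} (hs0 : 0 < s) (hs1 : s < 1) : 0 < fracConst n s := by
  have h1 := Real.Gamma_pos_of_pos (sub_pos.2 hs1)
  have h2 : 0 < Real.Gamma (n / 2 + s) := Real.Gamma_pos_of_pos (by positivity)
  unfold fracConst
  rw [abs_Gamma_neg hs0 hs1]
  have := Real.pi_pos
  positivity

lemma fracKernel_nonneg {n : ℕ} {s : ℝ} (hs0 : 0 < s) (hs1 : s < 1) (z : Rn n) :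
    0 ≤ fracKernel n s z := by
  have := fracConst_pos (n := n) hs0 hs1
  unfold fracKernel
  positivity

@[fun_prop]
lemma measurable_fracKernel (n : ℕ) (s : ℝ) : Measurable (fracKernel n s) := by
  unfold fracKernel
  fun_prop

lemma norm_exp_mul_I_sub_one_sq (t : ℝ) :
    ‖Complex.exp ((t : ℂ) * Complex.I) - 1‖ ^ 2 = 2 * (1 - Real.cos t) := by
  rw [← Complex.normSq_eq_norm_sq, Complex.normSq_apply]
  simp only [Complex.sub_re, Complex.exp_ofReal_mul_I_re, Complex.one_re, Complex.sub_im,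
    Complex.exp_ofReal_mul_I_im, Complex.one_im]
  nlinarith [Real.sin_sq_add_cos_sq t]

/-- The symbol of the Gagliardo seminorm: the constant `C_{n,s}` is normalized so that the
seminorm is `‖(-Δ)^{s/2} u‖_{L²}`. -/
lemma lintegral_fracKernel_mul_norm_sq {n : ℕ} {s : ℝ} (hs0 : 0 < s) (hs1 : s < 1) (ξ : Rn n) :
    ∫⁻ z : Rn n, ENNReal.ofReal (fracKernel n s z *
        ‖Complex.exp (((2 * Real.pi * inner ℝ z ξ : ℝ) : ℂ) * Complex.I) - 1‖ ^ 2) =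
      ENNReal.ofReal (‖(2 * Real.pi) • ξ‖ ^ (2 * s)) := by
  have hpi := Real.pi_pos
  have hC := fracConst_pos (n := n) hs0 hs1
  have h1 := Real.Gamma_pos_of_pos (sub_pos.2 hs1)
  have h2 : 0 < Real.Gamma (n / 2 + s) := Real.Gamma_pos_of_pos (by positivity)
  have h := lintegral_norm_rpow_mul_one_sub_cos (n := n) hs0 hs1 ξ
  have e0 : ∀ z : Rn n, ENNReal.ofReal (fracKernel n s z *
        ‖Complex.exp (((2 * Real.pi * inner ℝ z ξ : ℝ) : ℂ) * Complex.I) - 1‖ ^ 2) =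
      ENNReal.ofReal (fracConst n s / Real.Gamma (n / 2 + s)) *
      (ENNReal.ofReal (Real.Gamma (n / 2 + s)) * ENNReal.ofReal
        (‖z‖ ^ (-((n : ℝ) + 2 * s)) * (1 - Real.cos (2 * Real.pi * inner ℝ z ξ)))) := by
    intro z
    rw [← ENNReal.ofReal_mul h2.le, ← ENNReal.ofReal_mul (by positivity),
      norm_exp_mul_I_sub_one_sq, fracKernel]
    congr 1
    field_simp
  simp only [e0]
  rw [lintegral_const_mul' _ _ ENNReal.ofReal_ne_top,
    lintegral_const_mul' _ _ ENNReal.ofReal_ne_top, h, ← ENNReal.ofReal_mul (by positivity)]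
  congr 1
  rw [fracConst, abs_Gamma_neg hs0 hs1, norm_smul, Real.norm_of_nonneg (by positivity)]
  have e1 : (2 * Real.pi * ‖ξ‖) ^ (2 * s) = 4 ^ s * (Real.pi ^ 2 * ‖ξ‖ ^ 2) ^ s := by
    rw [← Real.mul_rpow (by norm_num) (by positivity), Real.rpow_mul (by positivity)]
    congr 1
    rw [Real.rpow_two]
    ring
  rw [e1]
  field_simp

/-! ### Fourier transform on `L²` -/

open FourierTransform

lemma hasTemperateGrowth_exp_mul_I :
    Function.HasTemperateGrowth (fun t : ℝ => Complex.exp ((t : ℂ) * Complex.I)) := by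
  have hit : ∀ k : ℕ, iteratedDeriv k (fun t : ℝ => Complex.exp ((t : ℂ) * Complex.I)) =
      fun t : ℝ => Complex.I ^ k * Complex.exp ((t : ℂ) * Complex.I) := by
    intro k
    induction k with
    | zero => simp
    | succ k ih =>
      rw [iteratedDeriv_succ, ih]
      ext t
      have h1 : HasDerivAt (fun t : ℝ => (t : ℂ) * Complex.I) (1 * Complex.I) t :=
        (Complex.ofRealCLM.hasDerivAt (x := t)).mul_const Complex.I
      have h2 := (h1.cexp).const_mul (Complex.I ^ k)
      rw [h2.deriv]
      ring
  refine ⟨?_, fun k => ⟨0, 1, fun t => ?_⟩⟩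
  · exact Complex.contDiff_exp.comp (Complex.ofRealCLM.contDiff.mul contDiff_const)
  · rw [norm_iteratedFDeriv_eq_norm_iteratedDeriv, hit]
    simp [Complex.norm_exp_ofReal_mul_I]

/-- The Fourier symbol `ξ ↦ exp(2πi z·ξ)` of the translation by `z`. -/
def phase {n : ℕ} (z ξ : Rn n) : ℂ :=
  Complex.exp (((2 * Real.pi * inner ℝ z ξ : ℝ) : ℂ) * Complex.I)

lemma hasTemperateGrowth_phase {n : ℕ} (z : Rn n) : (phase z).HasTemperateGrowth :=
  hasTemperateGrowth_exp_mul_I.comp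
    (((2 * Real.pi) • innerSL ℝ z).hasTemperateGrowth)

lemma norm_phase {n : ℕ} (z ξ : Rn n) : ‖phase z ξ‖ = 1 :=
  Complex.norm_exp_ofReal_mul_I _

@[fun_prop]
lemma continuous_uncurry_phase (n : ℕ) :
    Continuous (fun p : Rn n × Rn n => phase p.1 p.2) := by
  unfold phase
  fun_prop

lemma besselSymbol_pos {n : ℕ} (s : ℝ) (ξ : Rn n) : 0 < besselSymbol n s ξ := by
  unfold besselSymbol
  positivity

lemma besselSymbol_neg_mul {n : ℕ} (s : ℝ) (ξ : Rn n) :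
    besselSymbol n (-s) ξ * besselSymbol n s ξ = 1 := by
  have h : (0 : ℝ) < 1 + ‖(2 * Real.pi) • ξ‖ ^ 2 := by positivity
  rw [besselSymbol, besselSymbol, ← Real.rpow_add h]
  simp [neg_div]

lemma besselSymbol_neg_le_one {n : ℕ} {s : ℝ} (hs : 0 ≤ s) (ξ : Rn n) :
    besselSymbol n (-s) ξ ≤ 1 := by
  refine Real.rpow_le_one_of_one_le_of_nonpos ?_ (by linarith)
  nlinarith [norm_nonneg ((2 * Real.pi) • ξ)]

/-- Boundedness of `m` keeps `m F` in `L²`, and `L²` embeds injectively into tempered distributions,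
so the distributional identity becomes an almost everywhere one. -/
lemma ae_eq_mul_of_smulLeftCLM_eq {n : ℕ} {m : Rn n → ℂ} (hm : m.HasTemperateGrowth) {c : ℝ}
    (hb : ∀ ξ, ‖m ξ‖ ≤ c) {F G : Lp ℂ 2 (volume : Measure (Rn n))}
    (h : smulLeftCLM ℂ m (F : 𝓢'(Rn n, ℂ)) = (G : 𝓢'(Rn n, ℂ))) :
    (G : Rn n → ℂ) =ᵐ[volume] fun ξ => m ξ * F ξ := by
  have hm' : MemLp m ∞ (volume : Measure (Rn n)) :=
    memLp_top_of_bound hm.1.continuous.aestronglyMeasurable c (Filter.Eventually.of_forall hb)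
  rw [← Lp.toTemperedDistribution_smul_eq (r := 2) hm hm' F] at h
  have hk := Lp.ker_toTemperedDistributionCLM_eq_bot (F := ℂ)
    (μ := (volume : Measure (Rn n))) (p := 2)
  have h' : (hm'.toLp m • F : Lp ℂ 2 (volume : Measure (Rn n))) = G := LinearMap.ker_eq_bot.mp hk h
  rw [← h']
  filter_upwards [Lp.coeFn_lpSMul (r := 2) (hm'.toLp m) F, hm'.coeFn_toLp] with ξ h1 h2
  rw [h1]
  simp [h2]

lemma fourier_smulLeftCLM_phase {n : ℕ} (z : Rn n) (φ : 𝓢(Rn n, ℂ)) (x : Rn n) :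
    𝓕 (SchwartzMap.smulLeftCLM ℂ (phase z) φ) x = 𝓕 φ (x - z) := by
  simp only [SchwartzMap.fourier_coe, Real.fourier_eq']
  refine integral_congr_ae (Filter.Eventually.of_forall fun ξ => ?_)
  simp only [SchwartzMap.smulLeftCLM_apply_apply (hasTemperateGrowth_phase z), smul_eq_mul, phase]
  rw [← mul_assoc, ← Complex.exp_add]
  congr 2
  rw [inner_sub_right, real_inner_comm ξ z]
  push_cast
  ring

/-- The Fourier transform turns translations into multiplication with a phase. -/
lemma fourier_translate {n : ℕ} (z : Rn n) {U V : Lp ℂ 2 (volume : Measure (Rn n))}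
    (h : (V : Rn n → ℂ) =ᵐ[volume] fun x => U (x + z)) :
    (𝓕 V : Lp ℂ 2 (volume : Measure (Rn n))) =ᵐ[volume]
      fun ξ => phase z ξ * (𝓕 U : Lp ℂ 2 (volume : Measure (Rn n))) ξ := by
  refine ae_eq_mul_of_smulLeftCLM_eq (hasTemperateGrowth_phase z)
    (fun ξ => (norm_phase z ξ).le) ?_
  rw [← Lp.fourier_toTemperedDistribution_eq, ← Lp.fourier_toTemperedDistribution_eq]
  ext φ
  rw [smulLeftCLM_apply_apply, TemperedDistribution.fourier_apply,
    TemperedDistribution.fourier_apply, Lp.toTemperedDistribution_apply,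
    Lp.toTemperedDistribution_apply]
  simp only [fourier_smulLeftCLM_phase]
  rw [← integral_add_right_eq_self _ z]
  refine integral_congr_ae ?_
  filter_upwards [h] with x hx
  simp [hx]

/-- The inclusion of the real into the complex `L²`. -/
abbrev toComplexL2 (n : ℕ) :
    Lp ℝ 2 (volume : Measure (Rn n)) →L[ℝ] Lp ℂ 2 (volume : Measure (Rn n)) :=
  Complex.ofRealCLM.compLpL 2 volume

lemma coeFn_toComplexL2 {n : ℕ} (u : Lp ℝ 2 (volume : Measure (Rn n))) :
    (toComplexL2 n u : Rn n → ℂ) =ᵐ[volume] fun x => ((u x : ℝ) : ℂ) :=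
  Complex.ofRealCLM.coeFn_compLpL u

lemma norm_toComplexL2 {n : ℕ} (u : Lp ℝ 2 (volume : Measure (Rn n))) :
    ‖toComplexL2 n u‖ = ‖u‖ := by
  rw [Lp.norm_def, Lp.norm_def]
  congr 1
  refine eLpNorm_congr_norm_ae ?_
  filter_upwards [coeFn_toComplexL2 u] with x hx
  rw [hx, Complex.norm_real]

/-- The Fourier transform of a real `L²` function. -/
def fourierL2 {n : ℕ} (u : Lp ℝ 2 (volume : Measure (Rn n))) :
    Lp ℂ 2 (volume : Measure (Rn n)) := 𝓕 (toComplexL2 n u)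

lemma lintegral_enorm_sq {α E : Type*} [MeasurableSpace α] {μ : Measure α}
    [NormedAddCommGroup E] (f : Lp E 2 μ) : ∫⁻ x, ‖f x‖ₑ ^ 2 ∂μ = ‖f‖ₑ ^ 2 := by
  rw [Lp.enorm_def, eLpNorm_eq_lintegral_rpow_enorm_toReal (by norm_num) (by norm_num)]
  simp only [ENNReal.toReal_ofNat, ENNReal.rpow_ofNat, one_div]
  rw [← ENNReal.rpow_natCast, ← ENNReal.rpow_mul]
  simp

lemma lintegral_enorm_fourierL2 {n : ℕ} (u : Lp ℝ 2 (volume : Measure (Rn n))) :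
    ∫⁻ ξ, ‖fourierL2 u ξ‖ₑ ^ 2 = ‖u‖ₑ ^ 2 := by
  rw [lintegral_enorm_sq, ← ofReal_norm, fourierL2, Lp.norm_fourier_eq, norm_toComplexL2,
    ofReal_norm]

/-- Plancherel for the single difference `u(· + z) - u`; integrating in `z` later only needs
Tonelli. -/
lemma lintegral_translate_sub {n : ℕ} (u : Lp ℝ 2 (volume : Measure (Rn n))) (z : Rn n) :
    ∫⁻ x, ‖u (x + z) - u x‖ₑ ^ 2 = ∫⁻ ξ, ‖phase z ξ - 1‖ₑ ^ 2 * ‖fourierL2 u ξ‖ₑ ^ 2 := by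
  have hmp : MeasurePreserving (fun x : Rn n => x + z) := measurePreserving_add_right volume z
  set v : Lp ℝ 2 (volume : Measure (Rn n)) := Lp.compMeasurePreserving _ hmp u with hv
  have hvae : (v : Rn n → ℝ) =ᵐ[volume] fun x => u (x + z) :=
    Lp.coeFn_compMeasurePreserving u hmp
  have hV : (toComplexL2 n v : Rn n → ℂ) =ᵐ[volume] fun x => toComplexL2 n u (x + z) := by
    filter_upwards [coeFn_toComplexL2 v, hvae,
      hmp.quasiMeasurePreserving.ae (coeFn_toComplexL2 u)] with x h1 h2 h3
    rw [h1, h2, h3]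
  have h := fourier_translate z hV
  calc _ = ∫⁻ x, ‖(v - u : Lp ℝ 2 (volume : Measure (Rn n))) x‖ₑ ^ 2 := by
        refine lintegral_congr_ae ?_
        filter_upwards [hvae, Lp.coeFn_sub v u] with x h1 h2
        rw [h2, Pi.sub_apply, h1]
    _ = ∫⁻ ξ, ‖fourierL2 (v - u) ξ‖ₑ ^ 2 := by
        rw [lintegral_enorm_fourierL2, lintegral_enorm_sq]
    _ = _ := by
        refine lintegral_congr_ae ?_
        have e : fourierL2 (v - u) = fourierL2 v - fourierL2 u := by
          unfold fourierL2
          rw [map_sub]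
          exact map_sub (Lp.fourierTransformₗᵢ (Rn n) ℂ) _ _
        filter_upwards [h, Lp.coeFn_sub (fourierL2 v) (fourierL2 u)] with ξ h1 h2
        rw [e, h2, Pi.sub_apply, ← mul_pow, ← enorm_mul, sub_mul, one_mul]
        congr 3

/-! ### The norm of `H^s` on the Fourier side -/

lemma isFunction_toComplexL2 {n : ℕ} (u : Lp ℝ 2 (volume : Measure (Rn n))) :
    IsFunction (toComplexL2 n u : 𝓢'(Rn n, ℂ)) (fun x => ((u x : ℝ) : ℂ)) :=
  (isFunction_Lp _).congr (coeFn_toComplexL2 u)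

lemma Hs.bessel_eq_iff_besselD {n : ℕ} {s : ℝ} (u : Hs n s)
    (G : Lp ℂ 2 (volume : Measure (Rn n))) :
    u.bessel = G ↔ besselD n s (toComplexL2 n (Hs.toL2 n s u) : 𝓢'(Rn n, ℂ)) = G := by
  rw [Hs.bessel_eq_iff]
  constructor
  · rintro ⟨T, hT, hG⟩
    obtain rfl := hT.unique_left (isFunction_toComplexL2 (Hs.toL2 n s u))
    exact hG.unique_left (isFunction_Lp G)
  · intro h
    refine ⟨_, isFunction_toComplexL2 (Hs.toL2 n s u), ?_⟩
    rw [h]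
    exact isFunction_Lp G

/-- The identity is solved for the transform of `u` because the symbol of order `-s` is bounded by
one, whereas the symbol of order `s` is not a bounded multiplier of `L²`. -/
lemma Hs.fourierL2_ae_eq {n : ℕ} {s : ℝ} (hs : 0 ≤ s) (u : Hs n s) :
    (fourierL2 (Hs.toL2 n s u) : Rn n → ℂ) =ᵐ[volume] fun ξ =>
      (besselSymbol n (-s) ξ : ℂ) * (𝓕 u.bessel : Lp ℂ 2 (volume : Measure (Rn n))) ξ := by
  refine ae_eq_mul_of_smulLeftCLM_eq (hasTemperateGrowth_besselSymbol n (-s)) (c := 1)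
    (fun ξ => ?_) ?_
  · rw [Complex.norm_real, Real.norm_of_nonneg (besselSymbol_pos _ _).le]
    exact besselSymbol_neg_le_one hs ξ
  · have h := (Hs.bessel_eq_iff_besselD u u.bessel).1 rfl
    rw [← Lp.fourier_toTemperedDistribution_eq, ← h, besselD, fourierMultiplierCLM_apply,
      fourier_fourierInv_eq, smulLeftCLM_smulLeftCLM_apply (hasTemperateGrowth_besselSymbol n _)
      (hasTemperateGrowth_besselSymbol n _), fourierL2, ← Lp.fourier_toTemperedDistribution_eq]
    have e : ((fun ξ : Rn n => ((besselSymbol n (-s) ξ : ℝ) : ℂ)) *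
        (fun ξ : Rn n => ((besselSymbol n s ξ : ℝ) : ℂ))) = fun _ => 1 := by
      ext ξ
      rw [Pi.mul_apply, ← Complex.ofReal_mul, besselSymbol_neg_mul, Complex.ofReal_one]
    first
      | rw [e, smulLeftCLM_const, one_smul]
      | rw [mul_comm, e, smulLeftCLM_const, one_smul]

lemma Hs.enorm_sq {n : ℕ} {s : ℝ} (hs : 0 ≤ s) (u : Hs n s) :
    ‖u‖ₑ ^ 2 = ∫⁻ ξ, ENNReal.ofReal ((1 + ‖(2 * Real.pi) • ξ‖ ^ 2) ^ s) *
      ‖fourierL2 (Hs.toL2 n s u) ξ‖ₑ ^ 2 := by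
  have h1 : ‖u‖ₑ = ‖(𝓕 u.bessel : Lp ℂ 2 (volume : Measure (Rn n)))‖ₑ := by
    rw [← ofReal_norm, ← ofReal_norm, Lp.norm_fourier_eq, Hs.norm_def]
  rw [h1, ← lintegral_enorm_sq]
  refine lintegral_congr_ae ?_
  filter_upwards [Hs.fourierL2_ae_eq hs u] with ξ hξ
  have hpos : (0 : ℝ) < 1 + ‖(2 * Real.pi) • ξ‖ ^ 2 := by positivity
  have e : (1 + ‖(2 * Real.pi) • ξ‖ ^ 2) ^ s * besselSymbol n (-s) ξ ^ 2 = 1 := by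
    rw [besselSymbol, ← Real.rpow_natCast (_ ^ (-s / 2)), ← Real.rpow_mul hpos.le, ← Real.rpow_add hpos]
    simp
  rw [hξ, enorm_mul, mul_pow, ← mul_assoc, ← ofReal_norm (Complex.ofReal _), Complex.norm_real,
    Real.norm_of_nonneg (besselSymbol_pos _ _).le, ← ENNReal.ofReal_pow (besselSymbol_pos _ _).le,
    ← ENNReal.ofReal_mul (by positivity), e, ENNReal.ofReal_one, one_mul]

lemma Hs.norm_toL2_le {n : ℕ} {s : ℝ} (hs : 0 ≤ s) (u : Hs n s) : ‖Hs.toL2 n s u‖ ≤ ‖u‖ := by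
  rw [← enorm_le_iff_norm_le]
  refine (ENNReal.pow_le_pow_left_iff two_ne_zero).1 ?_
  rw [Hs.enorm_sq hs, ← lintegral_enorm_fourierL2]
  refine lintegral_mono fun ξ => ?_
  refine le_mul_of_one_le_left zero_le ?_
  rw [ENNReal.one_le_ofReal]
  refine Real.one_le_rpow ?_ hs
  nlinarith [norm_nonneg ((2 * Real.pi) • ξ)]

/-- A Cauchy sequence converges in `L²` together with its images under `⟨D⟩^s`. Continuity of
`⟨D⟩^s` on tempered distributions identifies the second limit as the image of the first, i.e. the
graph is closed. -/
lemma Hs.completeSpace {n : ℕ} {s : ℝ} (hs : 0 ≤ s) : CompleteSpace (Hs n s) := by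
  refine Metric.complete_of_cauchySeq_tendsto fun u hu => ?_
  have hL : CauchySeq fun k => Hs.toL2 n s (u k) := by
    rw [Metric.cauchySeq_iff] at hu ⊢
    intro ε hε
    obtain ⟨N, hN⟩ := hu ε hε
    refine ⟨N, fun k hk l hl => lt_of_le_of_lt ?_ (hN k hk l hl)⟩
    rw [dist_eq_norm, dist_eq_norm, ← map_sub]
    exact Hs.norm_toL2_le hs _
  have hB : CauchySeq fun k => Hs.besselMap n s (u k) := by
    rw [Metric.cauchySeq_iff] at hu ⊢
    exact hu
  obtain ⟨v, hv⟩ := cauchySeq_tendsto_of_complete hL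
  obtain ⟨G, hG⟩ := cauchySeq_tendsto_of_complete hB
  have h1 : Filter.Tendsto (fun k => besselD n s (Lp.toTemperedDistributionCLM ℂ volume 2
      (toComplexL2 n (Hs.toL2 n s (u k))))) Filter.atTop
      (nhds (besselD n s (Lp.toTemperedDistributionCLM ℂ volume 2 (toComplexL2 n v)))) :=
    (((besselD n s).continuous.comp (Lp.toTemperedDistributionCLM ℂ volume 2).continuous).comp
      (toComplexL2 n).continuous).continuousAt.tendsto.comp hv
  have h2 : Filter.Tendsto (fun k => Lp.toTemperedDistributionCLM ℂ volume 2
      (Hs.besselMap n s (u k))) Filter.atTop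
      (nhds (Lp.toTemperedDistributionCLM ℂ volume 2 G)) :=
    (Lp.toTemperedDistributionCLM ℂ volume 2).continuous.continuousAt.tendsto.comp hG
  have h3 : besselD n s (toComplexL2 n v : 𝓢'(Rn n, ℂ)) = (G : 𝓢'(Rn n, ℂ)) := by
    refine tendsto_nhds_unique h1 (h2.congr fun k => ?_)
    exact ((Hs.bessel_eq_iff_besselD (u k) _).1 rfl).symm
  have hmem : v ∈ sobolevSubmodule n s := by
    refine ⟨_, isFunction_toComplexL2 v, G, Lp.memLp G, ?_⟩
    rw [h3]
    exact isFunction_Lp G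
  let w : Hs n s := ⟨v, hmem⟩
  have hw : Hs.besselMap n s w = G := (Hs.bessel_eq_iff_besselD w G).2 h3
  refine ⟨w, ?_⟩
  rw [tendsto_iff_norm_sub_tendsto_zero] at hG ⊢
  refine hG.congr fun k => ?_
  rw [← hw, ← map_sub]
  rfl

/-- The inner product of `H^s`. -/
@[reducible]
def Hs.innerProductSpace (n : ℕ) (s : ℝ) : InnerProductSpace ℝ (Hs n s) :=
  InnerProductSpace.ofNorm ℝ fun u v => by
    have h := parallelogram_law_with_norm ℂ (Hs.besselMap n s u) (Hs.besselMap n s v)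
    rw [← map_add, ← map_sub] at h
    simp only [← sq]
    exact h

/-- Test functions belong to `H^s`. -/
lemma Hs.exists_eq_of_contDiff {n : ℕ} (s : ℝ) {φ : Rn n → ℝ} (hφ : ContDiff ℝ ∞ φ)
    (hc : HasCompactSupport φ) : ∃ u : Hs n s, (u : Rn n → ℝ) =ᵐ[volume] φ := by
  have hL : MemLp φ 2 (volume : Measure (Rn n)) := hφ.continuous.memLp_of_hasCompactSupport hc
  have hc' : HasCompactSupport fun x => ((φ x : ℝ) : ℂ) := hc.comp_left Complex.ofReal_zero
  let f : 𝓢(Rn n, ℂ) := hc'.toSchwartzMap (Complex.ofRealCLM.contDiff.comp hφ)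
  have hm : hL.toLp φ ∈ sobolevSubmodule n s := by
    let g : 𝓢(Rn n, ℂ) := SchwartzMap.fourierMultiplierCLM ℂ
      (fun ξ => ((besselSymbol n s ξ : ℝ) : ℂ)) f
    have e : toComplexL2 n (hL.toLp φ) = f.toLp 2 := by
      refine Lp.ext ?_
      filter_upwards [coeFn_toComplexL2 (hL.toLp φ), hL.coeFn_toLp, f.coeFn_toLp 2 volume]
        with x h1 h2 h3
      rw [h1, h2, h3]
      rfl
    have e2 : besselD n s (toComplexL2 n (hL.toLp φ) : 𝓢'(Rn n, ℂ)) =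
        ((g.toLp 2 : Lp ℂ 2 (volume : Measure (Rn n))) : 𝓢'(Rn n, ℂ)) := by
      rw [e, Lp.toTemperedDistribution_toLp_eq, Lp.toTemperedDistribution_toLp_eq, besselD,
        fourierMultiplierCLM_toTemperedDistributionCLM_eq (hasTemperateGrowth_besselSymbol n s)]
    have e3 : IsFunction (besselD n s (toComplexL2 n (hL.toLp φ) : 𝓢'(Rn n, ℂ)))
        (g.toLp 2 : Lp ℂ 2 (volume : Measure (Rn n))) := by
      rw [e2]
      exact isFunction_Lp _
    exact ⟨_, isFunction_toComplexL2 _, _, Lp.memLp _, e3⟩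
  exact ⟨⟨_, hm⟩, hL.coeFn_toLp⟩

/-! ### Weighted forms on `L²` -/

/-- The bilinear form `(f, g) ↦ ∫ θ f g` on `L²` with a bounded weight `θ`. -/
def weightedForm {α : Type*} [MeasurableSpace α] {μ : Measure α} {θ : α → ℝ}
    (hθ : MemLp θ ∞ μ) : Lp ℝ 2 μ →L[ℝ] Lp ℝ 2 μ →L[ℝ] ℝ :=
  (innerSL ℝ).comp ((ContinuousLinearMap.mul ℝ ℝ).holderL μ ∞ 2 2 (hθ.toLp θ))

lemma weightedForm_apply {α : Type*} [MeasurableSpace α] {μ : Measure α} {θ : α → ℝ}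
    (hθ : MemLp θ ∞ μ) (f g : Lp ℝ 2 μ) :
    weightedForm hθ f g = ∫ x, θ x * (f x * g x) ∂μ := by
  simp only [weightedForm, ContinuousLinearMap.comp_apply, innerSL_apply_apply, L2.inner_def]
  refine integral_congr_ae ?_
  filter_upwards [(ContinuousLinearMap.mul ℝ ℝ).coeFn_holder (r := 2) (hθ.toLp θ) f,
    hθ.coeFn_toLp] with x h1 h2
  simp only [ContinuousLinearMap.holderL_apply_apply, h1, h2, ContinuousLinearMap.mul_apply',
    RCLike.inner_apply, conj_trivial]
  ring

lemma integrable_weight_mul {α : Type*} [MeasurableSpace α] {μ : Measure α} {θ : α → ℝ}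
    (hθ : MemLp θ ∞ μ) (f g : Lp ℝ 2 μ) : Integrable (fun x => θ x * (f x * g x)) μ := by
  have h1 : MemLp (fun x => f x * g x) 1 μ := (Lp.memLp g).mul (Lp.memLp f)
  have h2 : MemLp (fun x => θ x * (f x * g x)) 1 μ := h1.mul hθ
  exact memLp_one_iff_integrable.1 h2

lemma L2_norm_sq_eq_integral {α : Type*} [MeasurableSpace α] {μ : Measure α} (f : Lp ℝ 2 μ) :
    ‖f‖ ^ 2 = ∫ x, f x * f x ∂μ := by
  rw [← real_inner_self_eq_norm_sq, L2.inner_def]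
  simp [sq]

lemma L2_integrable_sq {α : Type*} [MeasurableSpace α] {μ : Measure α} (f : Lp ℝ 2 μ) :
    Integrable (fun x => f x * f x) μ :=
  memLp_one_iff_integrable.1 ((Lp.memLp f).mul (Lp.memLp f))

lemma le_weightedForm_self {α : Type*} [MeasurableSpace α] {μ : Measure α} {θ : α → ℝ}
    (hθ : MemLp θ ∞ μ) {c : ℝ} (hc : ∀ᵐ x ∂μ, c ≤ θ x) (f : Lp ℝ 2 μ) :
    c * ‖f‖ ^ 2 ≤ weightedForm hθ f f := by
  rw [weightedForm_apply, L2_norm_sq_eq_integral, ← integral_const_mul]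
  refine integral_mono_ae ((L2_integrable_sq f).const_mul c) (integrable_weight_mul hθ f f) ?_
  filter_upwards [hc] with x hx
  exact mul_le_mul_of_nonneg_right hx (mul_self_nonneg _)

/-! ### The fractional gradient -/

/-- The scalar part `(C_{n,s}/2)^{1/2} (u(x) - u(y)) |x - y|^{-(n/2+s)}` of the fractional
gradient. -/
def fracDiff {n : ℕ} (s : ℝ) (u : Rn n → ℝ) (p : Rn n × Rn n) : ℝ :=
  √(fracKernel n s (p.1 - p.2)) * (u p.1 - u p.2)

/-- Both gradients are parallel to `x - y`, so only scalars matter; the factor `|x - y|` lowers the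
exponent `n/2 + s + 1` to that of the square root of the kernel. -/
lemma inner_fracGrad {n : ℕ} {s : ℝ} (hs0 : 0 < s) (hs1 : s < 1) (c : ℝ) (u v : Rn n → ℝ)
    (p : Rn n × Rn n) :
    inner ℝ (c • fracGrad s u p.1 p.2) (fracGrad s v p.1 p.2) =
      c * (fracDiff s u p * fracDiff s v p) := by
  have hC := fracConst_pos (n := n) hs0 hs1
  rcases eq_or_ne p.1 p.2 with h | h
  · simp [fracGrad, fracDiff, h]
  have hr : 0 < ‖p.1 - p.2‖ := norm_pos_iff.2 (sub_ne_zero.2 h)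
  have e : √(fracKernel n s (p.1 - p.2)) =
      √(fracConst n s / 2) * (‖p.1 - p.2‖ / ‖p.1 - p.2‖ ^ ((n : ℝ) / 2 + s + 1)) := by
    rw [fracKernel, Real.sqrt_mul (by positivity)]
    congr 1
    rw [Real.sqrt_eq_rpow, ← Real.rpow_mul hr.le]
    nth_rewrite 2 [← Real.rpow_one ‖p.1 - p.2‖]
    rw [← Real.rpow_sub hr]
    congr 1
    ring
  simp only [fracGrad, fracDiff, e, inner_smul_left, inner_smul_right, conj_trivial,
    real_inner_self_eq_norm_sq]
  ring

lemma measurable_fracDiff {n : ℕ} (s : ℝ) {u : Rn n → ℝ} (hu : Measurable u) :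
    Measurable (fracDiff s u) := by
  unfold fracDiff
  fun_prop

lemma fracDiff_congr {n : ℕ} (s : ℝ) {u v : Rn n → ℝ} (h : u =ᵐ[volume] v) :
    fracDiff s u =ᵐ[volume] fracDiff s v := by
  filter_upwards [(Measure.quasiMeasurePreserving_fst (μ := volume) (ν := volume)).ae h,
    (Measure.quasiMeasurePreserving_snd (μ := volume) (ν := volume)).ae h] with p h1 h2
  rw [fracDiff, fracDiff, h1, h2]

/-- Substitute `x = y + z` and use Tonelli. The set `S` of admissible differences is the whole space
for the Fourier identity, the displacing translations for Poincaré, and `|z| ≥ δ` for the tail. -/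
lemma lintegral_fracDiff {n : ℕ} {s : ℝ} (hs0 : 0 < s) (hs1 : s < 1) {u : Rn n → ℝ}
    (hu : Measurable u) {S : Set (Rn n)} (hS : MeasurableSet S) :
    ∫⁻ p in {p : Rn n × Rn n | p.1 - p.2 ∈ S}, ‖fracDiff s u p‖ₑ ^ 2 =
      ∫⁻ z in S, ENNReal.ofReal (fracKernel n s z) * ∫⁻ x, ‖u (x + z) - u x‖ₑ ^ 2 := by
  have hT : MeasurableSet {p : Rn n × Rn n | p.1 - p.2 ∈ S} := (measurable_fst.sub measurable_snd) hS
  have hm : Measurable fun p : Rn n × Rn n => ‖fracDiff s u p‖ₑ ^ 2 :=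
    (measurable_fracDiff s hu).enorm.pow_const 2
  rw [← lintegral_indicator hT, ← lintegral_indicator hS, Measure.volume_eq_prod,
    lintegral_prod_symm _ (hm.indicator hT).aemeasurable]
  have h1 : ∀ y : Rn n, ∫⁻ x, {p : Rn n × Rn n | p.1 - p.2 ∈ S}.indicator
      (fun p => ‖fracDiff s u p‖ₑ ^ 2) (x, y) = ∫⁻ z, S.indicator
      (fun z => ENNReal.ofReal (fracKernel n s z) * ‖u (y + z) - u y‖ₑ ^ 2) z := by
    intro y
    rw [← lintegral_add_left_eq_self _ y]
    refine lintegral_congr fun z => ?_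
    have hiff : ((y + z, y) : Rn n × Rn n) ∈ {p : Rn n × Rn n | p.1 - p.2 ∈ S} ↔ z ∈ S := by simp
    by_cases hz : z ∈ S
    · rw [indicator_of_mem (hiff.2 hz), indicator_of_mem hz, fracDiff, enorm_mul, mul_pow]
      simp only [add_sub_cancel_left]
      rw [← enorm_pow, Real.sq_sqrt (fracKernel_nonneg hs0 hs1 z),
        Real.enorm_of_nonneg (fracKernel_nonneg hs0 hs1 z)]
    · rw [indicator_of_notMem (fun h => hz (hiff.1 h)), indicator_of_notMem hz]
  simp only [h1]
  rw [lintegral_lintegral_swap]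
  · refine lintegral_congr fun z => ?_
    by_cases hz : z ∈ S
    · simp only [indicator_of_mem hz]
      rw [lintegral_const_mul' _ _ ENNReal.ofReal_ne_top]
    · simp [indicator_of_notMem hz]
  · have e : (Function.uncurry fun (y z : Rn n) => S.indicator
        (fun z => ENNReal.ofReal (fracKernel n s z) * ‖u (y + z) - u y‖ₑ ^ 2) z) =
        (Prod.snd ⁻¹' S).indicator (fun q : Rn n × Rn n =>
          ENNReal.ofReal (fracKernel n s q.2) * ‖u (q.1 + q.2) - u q.1‖ₑ ^ 2) := by
      ext q
      by_cases hq : q.2 ∈ S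
      · rw [indicator_of_mem (show q ∈ Prod.snd ⁻¹' S from hq), Function.uncurry,
          indicator_of_mem hq]
      · rw [indicator_of_notMem (show q ∉ Prod.snd ⁻¹' S from hq), Function.uncurry,
          indicator_of_notMem hq]
    rw [e]
    refine (Measurable.indicator ?_ (measurable_snd hS)).aemeasurable
    fun_prop

lemma lintegral_fracDiff_eq_fourier {n : ℕ} {s : ℝ} (hs0 : 0 < s) (hs1 : s < 1)
    (u : Lp ℝ 2 (volume : Measure (Rn n))) :
    ∫⁻ p, ‖fracDiff s u p‖ₑ ^ 2 =
      ∫⁻ ξ, ENNReal.ofReal (‖(2 * Real.pi) • ξ‖ ^ (2 * s)) * ‖fourierL2 u ξ‖ₑ ^ 2 := by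
  have h := lintegral_fracDiff hs0 hs1 (Lp.stronglyMeasurable u).measurable MeasurableSet.univ
  simp only [mem_univ, Set.ofPred_true, Measure.restrict_univ, lintegral_translate_sub] at h
  have hU : Measurable (fourierL2 u) := (Lp.stronglyMeasurable (fourierL2 u)).measurable
  have hph : Measurable fun p : Rn n × Rn n => phase p.1 p.2 :=
    (continuous_uncurry_phase n).measurable
  rw [h]
  calc _ = ∫⁻ z : Rn n, ∫⁻ ξ : Rn n, ENNReal.ofReal (fracKernel n s z) *
          (‖phase z ξ - 1‖ₑ ^ 2 * ‖fourierL2 u ξ‖ₑ ^ 2) := by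
        refine lintegral_congr fun z => ?_
        rw [lintegral_const_mul' _ _ ENNReal.ofReal_ne_top]
    _ = ∫⁻ ξ : Rn n, ∫⁻ z : Rn n, ENNReal.ofReal (fracKernel n s z) *
          (‖phase z ξ - 1‖ₑ ^ 2 * ‖fourierL2 u ξ‖ₑ ^ 2) := by
        refine lintegral_lintegral_swap (Measurable.aemeasurable ?_)
        unfold Function.uncurry
        fun_prop
    _ = _ := by
        refine lintegral_congr fun ξ => ?_
        rw [← lintegral_fracKernel_mul_norm_sq hs0 hs1, ← lintegral_mul_const']
        · refine lintegral_congr fun z => ?_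
          rw [ENNReal.ofReal_mul (fracKernel_nonneg hs0 hs1 z), ← mul_assoc,
            ENNReal.ofReal_pow (norm_nonneg _), ofReal_norm, phase]
        · finiteness

lemma Hs.lintegral_fracDiff_le {n : ℕ} {s : ℝ} (hs0 : 0 < s) (hs1 : s < 1) (u : Hs n s) :
    ∫⁻ p, ‖fracDiff s u p‖ₑ ^ 2 ≤ ‖u‖ₑ ^ 2 := by
  rw [lintegral_fracDiff_eq_fourier hs0 hs1, Hs.enorm_sq hs0.le]
  refine lintegral_mono fun ξ => mul_le_mul_left ?_ _
  refine ENNReal.ofReal_le_ofReal ?_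
  rw [Real.rpow_mul (norm_nonneg _), Real.rpow_two]
  exact Real.rpow_le_rpow (by positivity) (by linarith) hs0.le

/-- On the Fourier side this is `(1 + t)^s ≤ 1 + t^s`, valid as `s ≤ 1`. Having constant one here is
what makes the final stability constant one. -/
lemma Hs.enorm_sq_le {n : ℕ} {s : ℝ} (hs0 : 0 < s) (hs1 : s < 1) (u : Hs n s) :
    ‖u‖ₑ ^ 2 ≤ ‖Hs.toL2 n s u‖ₑ ^ 2 + ∫⁻ p, ‖fracDiff s u p‖ₑ ^ 2 := by
  rw [lintegral_fracDiff_eq_fourier hs0 hs1, Hs.enorm_sq hs0.le, ← lintegral_enorm_fourierL2,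
    ← lintegral_add_left (by fun_prop)]
  refine lintegral_mono fun ξ => ?_
  rw [← one_add_mul]
  refine mul_le_mul_left ?_ _
  rw [← ENNReal.ofReal_one, ← ENNReal.ofReal_add zero_le_one (by positivity)]
  refine ENNReal.ofReal_le_ofReal ?_
  rw [Real.rpow_mul (norm_nonneg _), Real.rpow_two]
  have := Real.rpow_add_le_add_rpow (p := s) zero_le_one
    (sq_nonneg ‖(2 * Real.pi) • ξ‖) hs0.le hs1.le
  rwa [Real.one_rpow] at this

lemma Hs.memLp_fracDiff {n : ℕ} {s : ℝ} (hs0 : 0 < s) (hs1 : s < 1) (u : Hs n s) :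
    MemLp (fracDiff s u) 2 (volume : Measure (Rn n × Rn n)) := by
  refine ⟨(measurable_fracDiff s (Lp.stronglyMeasurable _).measurable).aestronglyMeasurable, ?_⟩
  rw [eLpNorm_lt_top_iff_lintegral_rpow_enorm_lt_top (by norm_num) (by norm_num)]
  simp only [ENNReal.toReal_ofNat, ENNReal.rpow_ofNat]
  exact (Hs.lintegral_fracDiff_le hs0 hs1 u).trans_lt (by finiteness)

/-- The scalar part of the fractional gradient as a linear map `H^s(ℝⁿ) → L²(ℝ²ⁿ)`. -/
def Hs.gradₗ (n : ℕ) {s : ℝ} (hs0 : 0 < s) (hs1 : s < 1) :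
    Hs n s →ₗ[ℝ] Lp ℝ 2 (volume : Measure (Rn n × Rn n)) where
  toFun u := (Hs.memLp_fracDiff hs0 hs1 u).toLp _
  map_add' u v := by
    rw [← MemLp.toLp_add]
    refine MemLp.toLp_congr _ _ ?_
    have h : ((u + v : Hs n s) : Rn n → ℝ) =ᵐ[volume] (u : Rn n → ℝ) + v := by
      rw [map_add]
      exact Lp.coeFn_add _ _
    refine (fracDiff_congr s h).trans (Filter.Eventually.of_forall fun p => ?_)
    simp only [fracDiff, Pi.add_apply]
    ring
  map_smul' c u := by
    rw [RingHom.id_apply, ← MemLp.toLp_const_smul]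
    refine MemLp.toLp_congr _ _ ?_
    have h : ((c • u : Hs n s) : Rn n → ℝ) =ᵐ[volume] c • (u : Rn n → ℝ) := by
      rw [map_smul]
      exact Lp.coeFn_smul _ _
    refine (fracDiff_congr s h).trans (Filter.Eventually.of_forall fun p => ?_)
    simp only [fracDiff, Pi.smul_apply, smul_eq_mul]
    ring

lemma Hs.coeFn_gradₗ {n : ℕ} {s : ℝ} (hs0 : 0 < s) (hs1 : s < 1) (u : Hs n s) :
    (Hs.gradₗ n hs0 hs1 u : Rn n × Rn n → ℝ) =ᵐ[volume] fracDiff s u :=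
  (Hs.memLp_fracDiff hs0 hs1 u).coeFn_toLp

lemma Hs.enorm_gradₗ_sq {n : ℕ} {s : ℝ} (hs0 : 0 < s) (hs1 : s < 1) (u : Hs n s) :
    ‖Hs.gradₗ n hs0 hs1 u‖ₑ ^ 2 = ∫⁻ p, ‖fracDiff s u p‖ₑ ^ 2 := by
  rw [← lintegral_enorm_sq]
  refine lintegral_congr_ae ?_
  filter_upwards [Hs.coeFn_gradₗ hs0 hs1 u] with p hp
  rw [hp]

lemma Hs.norm_gradₗ_le {n : ℕ} {s : ℝ} (hs0 : 0 < s) (hs1 : s < 1) (u : Hs n s) :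
    ‖Hs.gradₗ n hs0 hs1 u‖ ≤ ‖u‖ := by
  rw [← enorm_le_iff_norm_le]
  refine (ENNReal.pow_le_pow_left_iff two_ne_zero).1 ?_
  rw [Hs.enorm_gradₗ_sq]
  exact Hs.lintegral_fracDiff_le hs0 hs1 u

/-- The scalar part of the fractional gradient as a bounded map `H^s(ℝⁿ) → L²(ℝ²ⁿ)`. -/
def Hs.grad (n : ℕ) {s : ℝ} (hs0 : 0 < s) (hs1 : s < 1) :
    Hs n s →L[ℝ] Lp ℝ 2 (volume : Measure (Rn n × Rn n)) :=
  (Hs.gradₗ n hs0 hs1).mkContinuous 1 fun u => by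
    rw [one_mul]
    exact Hs.norm_gradₗ_le hs0 hs1 u

lemma Hs.coeFn_grad {n : ℕ} {s : ℝ} (hs0 : 0 < s) (hs1 : s < 1) (u : Hs n s) :
    (Hs.grad n hs0 hs1 u : Rn n × Rn n → ℝ) =ᵐ[volume] fracDiff s u :=
  Hs.coeFn_gradₗ hs0 hs1 u

lemma Hs.enorm_grad_sq {n : ℕ} {s : ℝ} (hs0 : 0 < s) (hs1 : s < 1) (u : Hs n s) :
    ‖Hs.grad n hs0 hs1 u‖ₑ ^ 2 = ∫⁻ p, ‖fracDiff s u p‖ₑ ^ 2 :=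
  Hs.enorm_gradₗ_sq hs0 hs1 u

lemma Hs.norm_sq_le {n : ℕ} {s : ℝ} (hs0 : 0 < s) (hs1 : s < 1) (u : Hs n s) :
    ‖u‖ ^ 2 ≤ ‖Hs.toL2 n s u‖ ^ 2 + ‖Hs.grad n hs0 hs1 u‖ ^ 2 := by
  have h := Hs.enorm_sq_le hs0 hs1 u
  rw [← Hs.enorm_grad_sq hs0 hs1, ← ofReal_norm, ← ofReal_norm, ← ofReal_norm,
    ← ENNReal.ofReal_pow (norm_nonneg _), ← ENNReal.ofReal_pow (norm_nonneg _),
    ← ENNReal.ofReal_pow (norm_nonneg _), ← ENNReal.ofReal_add (by positivity) (by positivity),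
    ENNReal.ofReal_le_ofReal_iff (by positivity)] at h
  exact h

/-! ### The abstract exterior value problem -/

section AbstractExterior

variable {H : Type*} [NormedAddCommGroup H] [InnerProductSpace ℝ H] {M : Submodule ℝ H}

lemma eq_of_form_coercive {B : H →L[ℝ] H →L[ℝ] ℝ} {c : ℝ} (hc : 0 < c)
    (hB : ∀ w ∈ M, c * ‖w‖ ^ 2 ≤ B w w) {f u v : H} (hu : ∀ φ ∈ M, B u φ = 0) (huf : u - f ∈ M)
    (hv : ∀ φ ∈ M, B v φ = 0) (hvf : v - f ∈ M) : u = v := by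
  have hw : u - v ∈ M := by
    have := M.sub_mem huf hvf
    rwa [sub_sub_sub_cancel_right] at this
  have h := hB _ hw
  have h0 : B (u - v) (u - v) = 0 := by
    rw [B.map_sub, sub_apply, hu _ hw, hv _ hw, sub_zero]
  rw [h0] at h
  have h1 : ‖u - v‖ ^ 2 ≤ 0 := by
    by_contra hcon
    push Not at hcon
    nlinarith
  have h2 : ‖u - v‖ = 0 := by nlinarith [norm_nonneg (u - v)]
  exact sub_eq_zero.1 (norm_eq_zero.1 h2)

/-- The solution operator of the abstract exterior value problem. -/
lemma exists_solution_operator [CompleteSpace H] [CompleteSpace M] (B : H →L[ℝ] H →L[ℝ] ℝ) {c : ℝ} (hc : 0 < c)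
    (hB : ∀ w ∈ M, c * ‖w‖ ^ 2 ≤ B w w) :
    ∃ P : H →L[ℝ] H, ∀ f, (∀ φ ∈ M, B (P f) φ = 0) ∧ P f - f ∈ M := by
  have hco : IsCoercive (B.bilinearComp M.subtypeL M.subtypeL) := by
    refine ⟨c, hc, fun w => ?_⟩
    have := hB w w.2
    rw [sq, ← mul_assoc] at this
    exact this
  let r : H →L[ℝ] M := M.orthogonalProjectionOnto.comp (InnerProductSpace.continuousLinearMapOfBilin B)
  have hr : ∀ f (φ : M), inner ℝ (r f) φ = B f φ := by
    intro f φ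
    rw [← InnerProductSpace.continuousLinearMapOfBilin_apply B f φ]
    exact M.inner_orthogonalProjectionOnto_eq_of_mem_right φ _
  let E := hco.continuousLinearEquivOfBilin
  -- `r f` represents `B f` on `M` and `E` represents `B` restricted to `M`, so `E.symm (r f)` is
  -- the element of `M` on which `B` acts like `f`; subtracting it from `f` gives the solution.
  refine ⟨ContinuousLinearMap.id ℝ H - (M.subtypeL.comp (E.symm : M →L[ℝ] M)).comp r,
    fun f => ⟨fun φ hφ => ?_, ?_⟩⟩
  · have h := hco.continuousLinearEquivOfBilin_apply (E.symm (r f)) ⟨φ, hφ⟩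
    rw [show hco.continuousLinearEquivOfBilin (E.symm (r f)) = r f from E.apply_symm_apply _,
      hr] at h
    simp only [ContinuousLinearMap.bilinearComp_apply, Submodule.subtypeL_apply] at h
    simp [h]
  · simp

/-- The form `B (P f) g` descends to the quotient in `f` because data in `M` have the zero solution,
and in `g` because of the weak equation itself. Lifting acts on the first argument, hence the two
flips. -/
lemma exists_DN_operator [CompleteSpace H] [CompleteSpace M] (B : H →L[ℝ] H →L[ℝ] ℝ) {c : ℝ}
    (hc : 0 < c) (hB : ∀ w ∈ M, c * ‖w‖ ^ 2 ≤ B w w) :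
    ∃ Λ : (H ⧸ M) →L[ℝ] (H ⧸ M) →L[ℝ] ℝ, ∀ f : H,
      (∃! u : H, (∀ φ ∈ M, B u φ = 0) ∧ u - f ∈ M) ∧
      ∀ u : H, (∀ φ ∈ M, B u φ = 0) ∧ u - f ∈ M → ∀ g : H, Λ (M.mkQ f) (M.mkQ g) = B u g := by
  obtain ⟨P, hP⟩ := exists_solution_operator B hc hB
  have hP0 : M ≤ (B.comp P).ker := by
    intro f hf
    have : P f = 0 := eq_of_form_coercive hc hB (hP f).1 (hP f).2 (by simp) (by simpa using hf)
    simp [this]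
  have hQ : M ≤ ((M.liftQL (B.comp P) hP0).flip).ker := by
    intro φ hφ
    rw [LinearMap.mem_ker]
    ext x
    obtain ⟨x, rfl⟩ := M.mkQ_surjective x
    exact (hP x).1 φ hφ
  refine ⟨(M.liftQL _ hQ).flip, fun f => ⟨⟨P f, hP f, fun v hv => ?_⟩, fun u hu g => ?_⟩⟩
  · exact eq_of_form_coercive hc hB hv.1 hv.2 (hP f).1 (hP f).2
  · rw [eq_of_form_coercive hc hB hu.1 hu.2 (hP f).1 (hP f).2]
    rfl

end AbstractExterior

/-! ### Well-posedness -/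

lemma exists_abs_le_of_memLp_top {α : Type*} [MeasurableSpace α] {μ : Measure α} {γ : α → ℝ}
    (hγ : MemLp γ ∞ μ) : ∃ C, ∀ᵐ x ∂μ, |γ x| ≤ C := by
  have h := hγ.2
  rw [eLpNorm_exponent_top] at h
  refine ⟨(eLpNormEssSup γ μ).toReal, ?_⟩
  filter_upwards [ae_le_eLpNormEssSup (f := γ) (μ := μ)] with x hx
  rw [← Real.norm_eq_abs, ← toReal_enorm]
  exact ENNReal.toReal_mono h.ne hx

lemma memLp_sqrt_mul_sqrt {n : ℕ} {γ : Rn n → ℝ} (hγ : MemLp γ ∞ volume) :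
    MemLp (fun p : Rn n × Rn n => √(γ p.1) * √(γ p.2)) ∞ volume := by
  have hm : AEStronglyMeasurable (fun x => √(γ x)) (volume : Measure (Rn n)) :=
    Real.continuous_sqrt.comp_aestronglyMeasurable hγ.1
  obtain ⟨C, hC⟩ := exists_abs_le_of_memLp_top hγ
  refine memLp_top_of_bound (hm.comp_fst.mul hm.comp_snd) C ?_
  filter_upwards [(Measure.quasiMeasurePreserving_fst (μ := volume) (ν := volume)).ae hC,
    (Measure.quasiMeasurePreserving_snd (μ := volume) (ν := volume)).ae hC] with p h1 h2
  have hC0 : 0 ≤ C := (abs_nonneg _).trans h1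
  rw [Real.norm_of_nonneg (by positivity), ← Real.mul_self_sqrt hC0]
  exact mul_le_mul (Real.sqrt_le_sqrt ((le_abs_self _).trans h1))
    (Real.sqrt_le_sqrt ((le_abs_self _).trans h2)) (Real.sqrt_nonneg _) (Real.sqrt_nonneg _)

lemma le_sqrt_mul_sqrt {n : ℕ} {γ : Rn n → ℝ} {γ₀ : ℝ} (hγ₀ : 0 < γ₀)
    (hγ : ∀ᵐ x, γ₀ ≤ γ x) : ∀ᵐ p : Rn n × Rn n, γ₀ ≤ √(γ p.1) * √(γ p.2) := by
  filter_upwards [(Measure.quasiMeasurePreserving_fst (μ := volume) (ν := volume)).ae hγ,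
    (Measure.quasiMeasurePreserving_snd (μ := volume) (ν := volume)).ae hγ] with p h1 h2
  rw [← Real.mul_self_sqrt hγ₀.le]
  exact mul_le_mul (Real.sqrt_le_sqrt h1) (Real.sqrt_le_sqrt h2) (Real.sqrt_nonneg _)
    (Real.sqrt_nonneg _)

/-- The bilinear form `B_γ` as a bounded bilinear form on `H^s`. -/
def conductivityForm {n : ℕ} {s : ℝ} (hs0 : 0 < s) (hs1 : s < 1) {γ : Rn n → ℝ}
    (hγ : MemLp γ ∞ volume) : Hs n s →L[ℝ] Hs n s →L[ℝ] ℝ :=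
  (weightedForm (memLp_sqrt_mul_sqrt hγ)).bilinearComp (Hs.grad n hs0 hs1) (Hs.grad n hs0 hs1)

lemma bilin_eq {n : ℕ} {s : ℝ} (hs0 : 0 < s) (hs1 : s < 1) {γ : Rn n → ℝ}
    (hγ : MemLp γ ∞ volume) (u v : Hs n s) :
    bilin γ u v = conductivityForm hs0 hs1 hγ u v := by
  rw [conductivityForm, ContinuousLinearMap.bilinearComp_apply, weightedForm_apply]
  refine integral_congr_ae ?_
  filter_upwards [Hs.coeFn_grad hs0 hs1 u, Hs.coeFn_grad hs0 hs1 v] with p h1 h2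
  rw [h1, h2, inner_fracGrad hs0 hs1]

/-! ### Poincaré inequality and coercivity -/

/-- The inclusion `H^s(ℝⁿ) → L²(ℝⁿ)` as a bounded map. -/
def Hs.toL2L (n : ℕ) {s : ℝ} (hs : 0 ≤ s) :
    Hs n s →L[ℝ] Lp ℝ 2 (volume : Measure (Rn n)) :=
  (Hs.toL2 n s).mkContinuous 1 fun u => by
    rw [one_mul]
    exact Hs.norm_toL2_le hs u

/-- A Poincaré inequality: `u` vanishes outside `A` and `A` is disjoint from its translates
by the elements of `S`. -/
lemma Hs.poincare {n : ℕ} {s : ℝ} (hs0 : 0 < s) (hs1 : s < 1) (u : Hs n s) {A S : Set (Rn n)}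
    (hS : MeasurableSet S) (hu : ∀ᵐ x, x ∉ A → (u : Rn n → ℝ) x = 0)
    (hAS : ∀ z ∈ S, ∀ x ∈ A, x + z ∉ A) :
    (∫⁻ z in S, ENNReal.ofReal (fracKernel n s z)) * ‖Hs.toL2 n s u‖ₑ ^ 2 ≤
      ‖Hs.grad n hs0 hs1 u‖ₑ ^ 2 := by
  have hm := (Lp.stronglyMeasurable (Hs.toL2 n s u)).measurable
  have hk : Measurable fun z => ENNReal.ofReal (fracKernel n s z) := by fun_prop
  rw [Hs.enorm_grad_sq]
  calc _ = ∫⁻ z in S, ENNReal.ofReal (fracKernel n s z) * ‖Hs.toL2 n s u‖ₑ ^ 2 :=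
        (lintegral_mul_const _ hk).symm
    _ ≤ ∫⁻ z in S, ENNReal.ofReal (fracKernel n s z) *
          ∫⁻ x, ‖(u : Rn n → ℝ) (x + z) - (u : Rn n → ℝ) x‖ₑ ^ 2 := by
        refine setLIntegral_mono' hS fun z hz => ?_
        refine mul_le_mul_right ?_ _
        rw [← lintegral_enorm_sq]
        refine lintegral_mono_ae ?_
        filter_upwards [hu, (measurePreserving_add_right volume z).quasiMeasurePreserving.ae hu]
          with x h1 h2
        -- On `A` the translated value vanishes and the difference is `-u x`; off `A` there is
        -- nothing to bound.
        by_cases hx : x ∈ A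
        · rw [h2 (hAS z hz x hx), zero_sub, enorm_neg]
        · rw [h1 hx]
          simp
    _ = ∫⁻ p in {p : Rn n × Rn n | p.1 - p.2 ∈ S}, ‖fracDiff s u p‖ₑ ^ 2 :=
        (lintegral_fracDiff hs0 hs1 hm hS).symm
    _ ≤ _ := setLIntegral_le_lintegral _ _

lemma fracKernel_pos {n : ℕ} {s : ℝ} (hs0 : 0 < s) (hs1 : s < 1) {z : Rn n} (hz : z ≠ 0) :
    0 < fracKernel n s z := by
  have := fracConst_pos (n := n) hs0 hs1
  have := norm_pos_iff.2 hz
  unfold fracKernel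
  positivity

lemma setLIntegral_fracKernel_pos {n : ℕ} {s : ℝ} (hs0 : 0 < s) (hs1 : s < 1) {S : Set (Rn n)}
    (hS : IsOpen S) (hne : S.Nonempty) (h0 : 0 ∉ S) :
    0 < ∫⁻ z in S, ENNReal.ofReal (fracKernel n s z) := by
  rw [setLIntegral_pos_iff (by fun_prop)]
  have e : (Function.support fun z : Rn n => ENNReal.ofReal (fracKernel n s z)) ∩ S = S := by
    refine inter_eq_right.2 fun z hz => ?_
    have hz0 : z ≠ 0 := fun h => h0 (h ▸ hz)
    simp [fracKernel_pos hs0 hs1 hz0]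
  rw [e]
  exact hS.measure_pos volume hne

/-- After the rigid motion one coordinate is bounded by `R'` on `Ω`, so any translation moving it by
more than the width `2 * R'` pushes `Ω` off itself. -/
lemma BoundedInOneDirection.exists_translates {n : ℕ} {Ω : Set (Rn n)}
    (h : BoundedInOneDirection Ω) :
    ∃ S : Set (Rn n), IsOpen S ∧ S.Nonempty ∧ 0 ∉ S ∧ ∀ z ∈ S, ∀ x ∈ Ω, x + z ∉ Ω := by
  obtain ⟨j, k, hjk, T, A, hk, -, hT, hΩ⟩ := h
  obtain ⟨R, hR⟩ := hT.exists_norm_le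
  set i : Fin n := Fin.cast hjk (Fin.natAdd j ⟨0, hk⟩) with hi
  -- The maximum with `0` ensures `0 ∉ S` even if `Ω` is empty and `R` negative.
  set R' := max R 0 with hR'
  have hcoord : ∀ x ∈ Ω, |(A.symm x) i| ≤ R' := by
    intro x hx
    obtain ⟨y, hy, rfl⟩ := hΩ hx
    rw [A.symm_apply_apply]
    refine le_trans ?_ ((hR _ hy).trans (le_max_left _ _))
    have := PiLp.norm_apply_le (WithLp.toLp 2
      (fun i : Fin k => y (Fin.cast hjk (Fin.natAdd j i))) : Rn k) ⟨0, hk⟩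
    exact this
  have hadd : ∀ x z : Rn n, A.symm (x + z) = A.symm x + A.symm.linearIsometryEquiv z := by
    intro x z
    have := A.symm.map_vadd x z
    rwa [vadd_eq_add, vadd_eq_add, add_comm, add_comm (A.symm.linearIsometryEquiv z)] at this
  refine ⟨{z | 2 * R' < (A.symm.linearIsometryEquiv z) i}, ?_, ?_, ?_, ?_⟩
  · refine isOpen_lt continuous_const ?_
    have := A.symm.linearIsometryEquiv.continuous
    fun_prop
  · refine ⟨A.symm.linearIsometryEquiv.symm (EuclideanSpace.single i (2 * R' + 1)), ?_⟩
    simp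
  · simp [hR']
  · intro z hz x hx hxz
    have h1 := abs_le.1 (hcoord x hx)
    have h2 := abs_le.1 (hcoord _ hxz)
    rw [hadd, PiLp.add_apply] at h2
    have : 2 * R' < (A.symm.linearIsometryEquiv z) i := hz
    linarith [h1.1, h2.2]

lemma eq_zero_of_mem_testSubmodule {n : ℕ} {s : ℝ} {Ω : Set (Rn n)} {u : Hs n s}
    (hu : u ∈ testSubmodule s Ω) : ∀ᵐ x, x ∉ Ω → (u : Rn n → ℝ) x = 0 := by
  obtain ⟨φ, -, -, hφ, h⟩ := hu
  filter_upwards [h] with x hx hxΩ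
  rw [hx]
  exact image_eq_zero_of_notMem_tsupport fun h => hxΩ (hφ h)

lemma HsTilde_subset_of_isClosed {n : ℕ} {s : ℝ} {Ω : Set (Rn n)} {p : Hs n s → Prop}
    (hp : IsClosed {u | p u}) (h : ∀ u ∈ testSubmodule s Ω, p u) {u : Hs n s}
    (hu : u ∈ HsTilde s Ω) : p u :=
  closure_minimal (s := (testSubmodule s Ω : Set (Hs n s))) h hp hu

lemma exists_poincare_const {n : ℕ} {s : ℝ} (hs0 : 0 < s) (hs1 : s < 1) {Ω : Set (Rn n)}
    (hΩ : BoundedInOneDirection Ω) :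
    ∃ c : ℝ, 0 < c ∧ ∀ u ∈ HsTilde s Ω, c * ‖Hs.toL2 n s u‖ ^ 2 ≤ ‖Hs.grad n hs0 hs1 u‖ ^ 2 := by
  obtain ⟨S, hS, hne, h0, htr⟩ := hΩ.exists_translates
  -- The kernel may have infinite mass on `S`, so a finite positive constant below it is chosen.
  obtain ⟨c, hc0, hc⟩ := ENNReal.lt_iff_exists_nnreal_btwn.1
    (setLIntegral_fracKernel_pos hs0 hs1 hS hne h0)
  refine ⟨c, by exact_mod_cast hc0, fun u hu => ?_⟩
  refine HsTilde_subset_of_isClosed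
    (p := fun u => c * ‖Hs.toL2 n s u‖ ^ 2 ≤ ‖Hs.grad n hs0 hs1 u‖ ^ 2) ?_ (fun u hu => ?_) hu
  · refine isClosed_le ?_ ?_
    · exact continuous_const.mul ((Hs.toL2L n hs0.le).continuous.norm.pow 2)
    · exact (Hs.grad n hs0 hs1).continuous.norm.pow 2
  · have h := (mul_le_mul_left hc.le _).trans
      (Hs.poincare hs0 hs1 u hS.measurableSet (eq_zero_of_mem_testSubmodule hu) htr)
    rw [← ofReal_norm, ← ofReal_norm, ← ENNReal.ofReal_pow (norm_nonneg _),
      ← ENNReal.ofReal_pow (norm_nonneg _), ← ENNReal.ofReal_coe_nnreal,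
      ← ENNReal.ofReal_mul (by positivity), ENNReal.ofReal_le_ofReal_iff (by positivity)] at h
    exact h

lemma exists_coercive_const {n : ℕ} {s : ℝ} (hs0 : 0 < s) (hs1 : s < 1) {Ω : Set (Rn n)}
    (hΩ : BoundedInOneDirection Ω) {γ : Rn n → ℝ} {γ₀ : ℝ} (hγ₀ : 0 < γ₀)
    (hγ : MemLp γ ∞ volume) (hpos : ∀ᵐ x, γ₀ ≤ γ x) :
    ∃ c : ℝ, 0 < c ∧ ∀ u ∈ HsTilde s Ω, c * ‖u‖ ^ 2 ≤ conductivityForm hs0 hs1 hγ u u := by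
  obtain ⟨c, hc, h⟩ := exists_poincare_const hs0 hs1 hΩ
  -- Poincaré gives `‖u‖² ≤ (1/c + 1)[u]²`, whose inverse constant is `c / (1 + c)`.
  refine ⟨γ₀ * (c / (1 + c)), by positivity, fun u hu => ?_⟩
  have h1 := h u hu
  have h2 := Hs.norm_sq_le hs0 hs1 u
  have h3 : γ₀ * ‖Hs.grad n hs0 hs1 u‖ ^ 2 ≤ conductivityForm hs0 hs1 hγ u u :=
    le_weightedForm_self _ (le_sqrt_mul_sqrt hγ₀ hpos) _
  refine le_trans ?_ h3
  rw [mul_assoc]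
  refine mul_le_mul_of_nonneg_left ?_ hγ₀.le
  rw [div_mul_eq_mul_div, div_le_iff₀ (by positivity)]
  nlinarith

lemma exists_isDNMap {n : ℕ} {s : ℝ} (hs0 : 0 < s) (hs1 : s < 1) {Ω : Set (Rn n)}
    (hΩ : BoundedInOneDirection Ω) {γ : Rn n → ℝ} {γ₀ : ℝ} (hγ₀ : 0 < γ₀)
    (hγ : MemLp γ ∞ volume) (hpos : ∀ᵐ x, γ₀ ≤ γ x) :
    ∃ Λ, IsDNMap (s := s) Ω γ Λ := by
  obtain ⟨c, hc, h⟩ := exists_coercive_const hs0 hs1 hΩ hγ₀ hγ hpos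
  let _ := Hs.innerProductSpace n s
  have := Hs.completeSpace (n := n) hs0.le
  have : CompleteSpace (HsTilde s Ω) :=
    (testSubmodule s Ω).isClosed_topologicalClosure.completeSpace_coe
  obtain ⟨Λ, hΛ⟩ := exists_DN_operator (conductivityForm hs0 hs1 hγ) hc h
  refine ⟨Λ, fun f => ?_⟩
  simp only [IsWeakSolution, bilin_eq hs0 hs1 hγ]
  exact hΛ f

lemma isDNMap_dnMap {n : ℕ} {s : ℝ} (hs0 : 0 < s) (hs1 : s < 1) {Ω : Set (Rn n)}
    (hΩ : BoundedInOneDirection Ω) {γ : Rn n → ℝ} {γ₀ : ℝ} (hγ₀ : 0 < γ₀)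
    (hγ : MemLp γ ∞ volume) (hpos : ∀ᵐ x, γ₀ ≤ γ x) :
    IsDNMap Ω γ (dnMap s Ω γ) := by
  have h := exists_isDNMap hs0 hs1 hΩ hγ₀ hγ hpos
  rw [dnMap, dif_pos h]
  exact h.choose_spec

/-! ### Exterior determination -/

lemma weightedForm_comm {α : Type*} [MeasurableSpace α] {μ : Measure α} {θ : α → ℝ}
    (hθ : MemLp θ ∞ μ) (f g : Lp ℝ 2 μ) : weightedForm hθ f g = weightedForm hθ g f := by
  simp only [weightedForm_apply, mul_comm (f _)]

/-- For `|z| ≥ δ` one has `1/|z| ≤ ((1 + δ)/δ) / (1 + |z|)`, and `(1 + |z|)^{-(n + 2s)}` is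
integrable as `n + 2s > n`. -/
lemma lintegral_fracKernel_lt_top {n : ℕ} {s : ℝ} (hs0 : 0 < s) (hs1 : s < 1) {δ : ℝ}
    (hδ : 0 < δ) : ∫⁻ z in {z : Rn n | δ ≤ ‖z‖}, ENNReal.ofReal (fracKernel n s z) < ⊤ := by
  have hC := fracConst_pos (n := n) hs0 hs1
  set r : ℝ := (n : ℝ) + 2 * s with hr
  have hr0 : 0 < r := by positivity
  have hint : Integrable (fun z : Rn n => (fracConst n s / 2 * ((1 + δ) / δ) ^ r) *
      (1 + ‖z‖) ^ (-r)) volume := by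
    refine (integrable_one_add_norm ?_).const_mul _
    rw [finrank_euclideanSpace_fin]
    linarith
  have hS : MeasurableSet {z : Rn n | δ ≤ ‖z‖} := measurableSet_le measurable_const measurable_norm
  refine lt_of_le_of_lt ?_ (hint.integrableOn (s := {z : Rn n | δ ≤ ‖z‖})).lintegral_lt_top
  refine setLIntegral_mono' hS fun z (hz : δ ≤ ‖z‖) => ENNReal.ofReal_le_ofReal ?_
  have hz0 : 0 < ‖z‖ := hδ.trans_le hz
  rw [fracKernel, mul_assoc]
  refine mul_le_mul_of_nonneg_left ?_ (by positivity)
  rw [Real.rpow_neg hz0.le, Real.rpow_neg (by positivity), ← div_eq_mul_inv,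
    ← Real.div_rpow (by positivity) (by positivity), ← Real.inv_rpow hz0.le]
  refine Real.rpow_le_rpow (by positivity) ?_ hr0.le
  rw [div_div, inv_le_iff_one_le_mul₀ hz0, div_mul_eq_mul_div, le_div_iff₀ (by positivity)]
  nlinarith

/-- The part of the fractional gradient away from the diagonal is controlled by the `L²` norm. -/
lemma exists_tail {n : ℕ} {s : ℝ} (hs0 : 0 < s) (hs1 : s < 1) {δ : ℝ} (hδ : 0 < δ) :
    ∃ C : ℝ, 0 ≤ C ∧ ∀ u : Hs n s, ∃ F : Lp ℝ 2 (volume : Measure (Rn n × Rn n)),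
      (∀ᵐ p, (δ ≤ ‖p.1 - p.2‖ → F p = Hs.grad n hs0 hs1 u p) ∧ (‖p.1 - p.2‖ < δ → F p = 0)) ∧
      ‖F‖ ^ 2 ≤ C * ‖Hs.toL2 n s u‖ ^ 2 := by
  set S : Set (Rn n) := {z | δ ≤ ‖z‖} with hSdef
  have hS : MeasurableSet S := measurableSet_le measurable_const measurable_norm
  have hT : MeasurableSet {p : Rn n × Rn n | p.1 - p.2 ∈ S} :=
    (measurable_fst.sub measurable_snd) hS
  have hk := lintegral_fracKernel_lt_top (n := n) hs0 hs1 hδ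
  set κ := ∫⁻ z in S, ENNReal.ofReal (fracKernel n s z) with hκ
  -- `κ` is the kernel's mass away from the origin; `4` bounds `|phase - 1|²`.
  refine ⟨(κ * 4).toReal, ENNReal.toReal_nonneg, fun u => ?_⟩
  have hF := (Lp.memLp (Hs.grad n hs0 hs1 u)).indicator hT
  refine ⟨hF.toLp _, ?_, ?_⟩
  · filter_upwards [hF.coeFn_toLp] with p hp
    rw [hp]
    exact ⟨fun h => indicator_of_mem (by exact h) _,
      fun h => indicator_of_notMem (by exact not_le.2 h) _⟩
  · have key : ‖hF.toLp _‖ₑ ^ 2 ≤ κ * 4 * ‖Hs.toL2 n s u‖ₑ ^ 2 := by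
      calc ‖hF.toLp _‖ₑ ^ 2 = ∫⁻ p in {p : Rn n × Rn n | p.1 - p.2 ∈ S}, ‖fracDiff s u p‖ₑ ^ 2 := by
            rw [← lintegral_enorm_sq, ← lintegral_indicator hT]
            refine lintegral_congr_ae ?_
            filter_upwards [hF.coeFn_toLp, Hs.coeFn_grad hs0 hs1 u] with p h1 h2
            rw [h1]
            by_cases hp : p ∈ {p : Rn n × Rn n | p.1 - p.2 ∈ S}
            · rw [indicator_of_mem hp, indicator_of_mem hp, h2]
            · rw [indicator_of_notMem hp, indicator_of_notMem hp]
              simp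
        _ = ∫⁻ z in S, ENNReal.ofReal (fracKernel n s z) *
              ∫⁻ x, ‖(u : Rn n → ℝ) (x + z) - (u : Rn n → ℝ) x‖ₑ ^ 2 :=
            lintegral_fracDiff hs0 hs1 (Lp.stronglyMeasurable _).measurable hS
        _ ≤ ∫⁻ z in S, ENNReal.ofReal (fracKernel n s z) * (4 * ‖Hs.toL2 n s u‖ₑ ^ 2) := by
            refine lintegral_mono fun z => mul_le_mul_right ?_ _
            rw [lintegral_translate_sub, ← lintegral_enorm_fourierL2,
              ← lintegral_const_mul' _ _ (by norm_num)]
            refine lintegral_mono fun ξ => mul_le_mul_left ?_ _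
            have h2 : ‖phase z ξ - 1‖ₑ ≤ 2 := by
              rw [← ofReal_norm, ← ENNReal.ofReal_ofNat]
              refine ENNReal.ofReal_le_ofReal ((norm_sub_le _ _).trans ?_)
              rw [norm_phase, norm_one]
              norm_num
            calc ‖phase z ξ - 1‖ₑ ^ 2 ≤ 2 ^ 2 := pow_le_pow_left' h2 2
              _ = 4 := by norm_num
        _ = κ * 4 * ‖Hs.toL2 n s u‖ₑ ^ 2 := by
            rw [lintegral_mul_const _ (by fun_prop), mul_assoc]
    rw [← ofReal_norm, ← ofReal_norm, ← ENNReal.ofReal_pow (norm_nonneg _),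
      ← ENNReal.ofReal_pow (norm_nonneg _),
      ← ENNReal.ofReal_toReal (ENNReal.mul_ne_top hk.ne (by norm_num : (4 : ℝ≥0∞) ≠ ⊤)),
      ← ENNReal.ofReal_mul ENNReal.toReal_nonneg,
      ENNReal.ofReal_le_ofReal_iff (by positivity)] at key
    exact key

lemma ae_prod_of_ae {n : ℕ} {p : Rn n → Prop} (h : ∀ᵐ x, p x) :
    ∀ᵐ q : Rn n × Rn n, p q.1 ∧ p q.2 := by
  filter_upwards [(Measure.quasiMeasurePreserving_fst (μ := volume) (ν := volume)).ae h,
    (Measure.quasiMeasurePreserving_snd (μ := volume) (ν := volume)).ae h] with q h1 h2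
  exact ⟨h1, h2⟩

/-- If `|x - y| < δ`, the pair cannot meet both `A` and `Ω`, so one of the two differences vanishes
and the gradient of `φ` may be replaced by its tail `F`. This is checked for test functions `w` and
extends to the closure because both sides are continuous in `w`. -/
lemma abs_weightedForm_grad_le {n : ℕ} {s : ℝ} (hs0 : 0 < s) (hs1 : s < 1)
    {θ : Rn n × Rn n → ℝ} (hθ : MemLp θ ∞ volume) {Ω A : Set (Rn n)} {δ : ℝ} (hδ : 0 < δ)
    (hdist : ∀ x ∈ A, ∀ y ∈ Ω, δ ≤ ‖x - y‖) {φ w : Hs n s} (hw : w ∈ HsTilde s Ω)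
    (hφ : ∀ᵐ x, x ∉ A → (φ : Rn n → ℝ) x = 0)
    {F : Lp ℝ 2 (volume : Measure (Rn n × Rn n))}
    (hF : ∀ᵐ p : Rn n × Rn n, δ ≤ ‖p.1 - p.2‖ → F p = Hs.grad n hs0 hs1 φ p)
    (hF' : ∀ᵐ p : Rn n × Rn n, ‖p.1 - p.2‖ < δ → F p = 0) :
    |weightedForm hθ (Hs.grad n hs0 hs1 w) (Hs.grad n hs0 hs1 φ)| ≤
      ‖weightedForm hθ‖ * ‖Hs.grad n hs0 hs1 w‖ * ‖F‖ := by
  refine HsTilde_subset_of_isClosed (p := fun w =>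
    |weightedForm hθ (Hs.grad n hs0 hs1 w) (Hs.grad n hs0 hs1 φ)| ≤
      ‖weightedForm hθ‖ * ‖Hs.grad n hs0 hs1 w‖ * ‖F‖) ?_ (fun w hw => ?_) hw
  · refine isClosed_le ?_ ?_ <;> fun_prop
  · have e : weightedForm hθ (Hs.grad n hs0 hs1 w) (Hs.grad n hs0 hs1 φ) =
        weightedForm hθ (Hs.grad n hs0 hs1 w) F := by
      rw [weightedForm_apply, weightedForm_apply]
      refine integral_congr_ae ?_
      filter_upwards [hF, hF', Hs.coeFn_grad hs0 hs1 w, Hs.coeFn_grad hs0 hs1 φ,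
        ae_prod_of_ae hφ, ae_prod_of_ae (eq_zero_of_mem_testSubmodule hw)]
        with p h1 h2 h3 h4 h5 h6
      rcases le_or_gt δ ‖p.1 - p.2‖ with hp | hp
      · rw [h1 hp]
      · have hdisj : ∀ x ∈ A, x ∉ Ω := fun x hx hxΩ => by
          have := hdist x hx x hxΩ
          rw [sub_self, norm_zero] at this
          exact absurd this (not_le.2 hδ)
        have h7 : ¬ (p.1 ∈ A ∧ p.2 ∈ Ω) := fun h => not_le.2 hp (hdist _ h.1 _ h.2)
        have h8 : ¬ (p.2 ∈ A ∧ p.1 ∈ Ω) := fun h => not_le.2 hp (by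
          rw [norm_sub_rev]
          exact hdist _ h.1 _ h.2)
        have h9 : fracDiff s w p * fracDiff s φ p = 0 := by
          by_cases hA : p.1 ∈ A ∨ p.2 ∈ A
          · have : (w : Rn n → ℝ) p.1 = 0 ∧ (w : Rn n → ℝ) p.2 = 0 := by
              rcases hA with hA | hA
              · exact ⟨h6.1 (hdisj _ hA), h6.2 fun h => h7 ⟨hA, h⟩⟩
              · exact ⟨h6.1 fun h => h8 ⟨hA, h⟩, h6.2 (hdisj _ hA)⟩
            simp [fracDiff, this.1, this.2]
          · push Not at hA
            simp [fracDiff, h5.1 hA.1, h5.2 hA.2]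
        rw [h2 hp, h3, h4, h9]
        simp
    rw [e]
    exact (weightedForm hθ).le_opNorm₂ _ _

/-- Absorbs the norm `b` of the gradient of the correction `w`: both bounds are linear in the tail
norm `c`, so their combination is quadratic in it. -/
lemma le_sq_div_mul_sq {a b c g x : ℝ} (hg : 0 < g) (ha : 0 ≤ a) (hc : 0 ≤ c)
    (h : g * b ≤ a * c) (hx : x ≤ a * b * c) : x ≤ a ^ 2 / g * c ^ 2 := by
  refine hx.trans ?_
  have hb : b ≤ a * c / g := by
    rw [le_div_iff₀ hg]
    linarith
  calc a * b * c ≤ a * (a * c / g) * c := by gcongr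
    _ = _ := by ring

/-- The Dirichlet-to-Neumann map at an exterior value `φ` supported away from `Ω` is given by
the energy of `φ`, up to an error of the size of the `L²` norm. -/
lemma exists_abs_dnMap_sub_le {n : ℕ} {s : ℝ} (hs0 : 0 < s) (hs1 : s < 1) {Ω : Set (Rn n)}
    {γ : Rn n → ℝ} {γ₀ : ℝ} (hγ₀ : 0 < γ₀) (hγ : MemLp γ ∞ volume) (hpos : ∀ᵐ x, γ₀ ≤ γ x)
    {Λ : ExteriorSpace s Ω →L[ℝ] (ExteriorSpace s Ω →L[ℝ] ℝ)} (hΛ : IsDNMap Ω γ Λ)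
    {A : Set (Rn n)} {δ : ℝ} (hδ : 0 < δ) (hdist : ∀ x ∈ A, ∀ y ∈ Ω, δ ≤ ‖x - y‖) :
    ∃ C : ℝ, ∀ φ : Hs n s, (∀ᵐ x, x ∉ A → (φ : Rn n → ℝ) x = 0) →
      |Λ (exteriorMk s Ω φ) (exteriorMk s Ω φ) - conductivityForm hs0 hs1 hγ φ φ| ≤
        C * ‖Hs.toL2 n s φ‖ ^ 2 := by
  obtain ⟨C, hC0, hC⟩ := exists_tail (n := n) hs0 hs1 hδ
  set Θ := weightedForm (memLp_sqrt_mul_sqrt hγ) with hΘ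
  refine ⟨‖Θ‖ ^ 2 / γ₀ * C, fun φ hφ => ?_⟩
  obtain ⟨F, hF, hFn⟩ := hC φ
  obtain ⟨⟨u, hu, -⟩, hΛφ⟩ := hΛ φ
  have hB := bilin_eq hs0 hs1 hγ
  set w := u - φ with hw
  have hwM : w ∈ HsTilde s Ω := hu.2
  have hest : |Θ (Hs.grad n hs0 hs1 w) (Hs.grad n hs0 hs1 φ)| ≤
      ‖Θ‖ * ‖Hs.grad n hs0 hs1 w‖ * ‖F‖ :=
    abs_weightedForm_grad_le hs0 hs1 _ hδ hdist hwM hφ (hF.mono fun p h => h.1)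
      (hF.mono fun p h => h.2)
  have h0 : Θ (Hs.grad n hs0 hs1 u) (Hs.grad n hs0 hs1 w) = 0 := by
    have := hu.1 w hwM
    rw [hB] at this
    exact this
  have hlow : γ₀ * ‖Hs.grad n hs0 hs1 w‖ ^ 2 ≤ Θ (Hs.grad n hs0 hs1 w) (Hs.grad n hs0 hs1 w) :=
    le_weightedForm_self _ (le_sqrt_mul_sqrt hγ₀ hpos) _
  have hu' : u = w + φ := by rw [hw, sub_add_cancel]
  -- The weak equation is tested with the correction `w` itself, bounding its energy by the cross
  -- term.
  have h1 : Θ (Hs.grad n hs0 hs1 w) (Hs.grad n hs0 hs1 w) =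
      -Θ (Hs.grad n hs0 hs1 w) (Hs.grad n hs0 hs1 φ) := by
    rw [hu', map_add, map_add, add_apply, weightedForm_comm _ (Hs.grad n hs0 hs1 φ)] at h0
    linarith
  have h2 : γ₀ * ‖Hs.grad n hs0 hs1 w‖ ≤ ‖Θ‖ * ‖F‖ := by
    rcases (norm_nonneg (Hs.grad n hs0 hs1 w)).eq_or_lt with h | h
    · rw [← h, mul_zero]
      positivity
    · refine le_of_mul_le_mul_right ?_ h
      have := neg_le_abs (Θ (Hs.grad n hs0 hs1 w) (Hs.grad n hs0 hs1 φ))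
      nlinarith
  have h3 : Λ (exteriorMk s Ω φ) (exteriorMk s Ω φ) - conductivityForm hs0 hs1 hγ φ φ =
      Θ (Hs.grad n hs0 hs1 w) (Hs.grad n hs0 hs1 φ) := by
    rw [hΛφ u hu φ, hB, hu', map_add, add_apply, add_sub_cancel_right]
    rfl
  rw [h3]
  refine (le_sq_div_mul_sq (a := ‖Θ‖) (c := ‖F‖) hγ₀ (norm_nonneg Θ) (norm_nonneg F) h2 hest).trans ?_
  rw [mul_assoc]
  exact mul_le_mul_of_nonneg_left hFn (div_nonneg (sq_nonneg _) hγ₀.le)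

/-- Where the conductivity is almost constant, the energy is almost a multiple of the
Gagliardo seminorm, up to an error of the size of the `L²` norm. -/
lemma exists_abs_conductivityForm_sub_le {n : ℕ} {s : ℝ} (hs0 : 0 < s) (hs1 : s < 1)
    {γ : Rn n → ℝ} (hγ : MemLp γ ∞ volume) {x₀ : Rn n} {r ε a : ℝ} (hr : 0 < r)
    (hε : 0 ≤ ε)
    (h : ∀ x ∈ Metric.ball x₀ (2 * r), ∀ y ∈ Metric.ball x₀ (2 * r),
      |√(γ x) * √(γ y) - a| ≤ ε) :
    ∃ C : ℝ, ∀ φ : Hs n s, (∀ᵐ x, x ∉ Metric.ball x₀ r → (φ : Rn n → ℝ) x = 0) →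
      |conductivityForm hs0 hs1 hγ φ φ - a * ‖Hs.grad n hs0 hs1 φ‖ ^ 2| ≤
        ε * ‖Hs.grad n hs0 hs1 φ‖ ^ 2 + C * ‖Hs.toL2 n s φ‖ ^ 2 := by
  obtain ⟨C, hC0, hC⟩ := exists_tail (n := n) hs0 hs1 hr
  have hθ := memLp_sqrt_mul_sqrt hγ
  obtain ⟨K, hK⟩ := exists_abs_le_of_memLp_top hθ
  refine ⟨(|K| + |a|) * C, fun φ hφ => ?_⟩
  obtain ⟨F, hF, hFn⟩ := hC φ
  set D := Hs.grad n hs0 hs1 φ with hD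
  have e1 : conductivityForm hs0 hs1 hγ φ φ - a * ‖D‖ ^ 2 =
      ∫ p, (√(γ p.1) * √(γ p.2) * (D p * D p) - a * (D p * D p)) := by
    rw [integral_sub (integrable_weight_mul hθ D D) ((L2_integrable_sq D).const_mul a),
      integral_const_mul, ← L2_norm_sq_eq_integral, ← weightedForm_apply hθ]
    rfl
  rw [e1]
  calc _ ≤ ∫ p, |√(γ p.1) * √(γ p.2) * (D p * D p) - a * (D p * D p)| :=
        abs_integral_le_integral_abs
    _ ≤ ∫ p, (ε * (D p * D p) + (|K| + |a|) * (F p * F p)) := by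
        refine integral_mono_ae
          ((integrable_weight_mul hθ D D).sub ((L2_integrable_sq D).const_mul a)).abs
          (((L2_integrable_sq D).const_mul ε).add ((L2_integrable_sq F).const_mul _)) ?_
        filter_upwards [hF, hK, ae_prod_of_ae hφ, Hs.coeFn_grad hs0 hs1 φ] with p h1 h2 h3 h4
        rw [← sub_mul, abs_mul, abs_mul_self]
        have hFF := mul_self_nonneg (F p)
        have hDD := mul_self_nonneg (D p)
        -- Three cases: both points in the double ball, where `γ` is nearly constant; points at
        -- distance at least `r`, where the tail `F` takes over; otherwise nearby points not both in
        -- the double ball, so neither lies in the small ball and `φ` vanishes at both.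
        by_cases hp : p.1 ∈ Metric.ball x₀ (2 * r) ∧ p.2 ∈ Metric.ball x₀ (2 * r)
        · have := mul_le_mul_of_nonneg_right (h _ hp.1 _ hp.2) hDD
          have : 0 ≤ (|K| + |a|) * (F p * F p) := by positivity
          linarith
        · rcases le_or_gt r ‖p.1 - p.2‖ with hd | hd
          · rw [h1.1 hd]
            have h5 : |√(γ p.1) * √(γ p.2) - a| ≤ |K| + |a| :=
              (abs_sub _ _).trans (add_le_add_left (h2.trans (le_abs_self K)) _)
            have := mul_le_mul_of_nonneg_right h5 hDD
            have : 0 ≤ ε * (D p * D p) := by positivity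
            linarith
          · have hn1 : p.1 ∉ Metric.ball x₀ r := fun hx => hp (by
              rw [Metric.mem_ball] at hx
              refine ⟨Metric.mem_ball.2 (by linarith), Metric.mem_ball.2 ?_⟩
              have := dist_triangle_left p.2 x₀ p.1
              rw [dist_eq_norm p.1 p.2] at this
              linarith)
            have hn2 : p.2 ∉ Metric.ball x₀ r := fun hx => hp (by
              rw [Metric.mem_ball] at hx
              refine ⟨Metric.mem_ball.2 ?_, Metric.mem_ball.2 (by linarith)⟩
              have := dist_triangle p.1 p.2 x₀
              rw [dist_eq_norm p.1 p.2] at this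
              linarith)
            have h0 : D p = 0 := by rw [h4, fracDiff, h3.1 hn1, h3.2 hn2]; simp
            rw [h0]
            simp only [mul_zero, zero_add]
            positivity
    _ = ε * ‖D‖ ^ 2 + (|K| + |a|) * ‖F‖ ^ 2 := by
        rw [integral_add ((L2_integrable_sq D).const_mul ε) ((L2_integrable_sq F).const_mul _),
          integral_const_mul, integral_const_mul, ← L2_norm_sq_eq_integral,
          ← L2_norm_sq_eq_integral]
    _ ≤ ε * ‖D‖ ^ 2 + (|K| + |a|) * (C * ‖Hs.toL2 n s φ‖ ^ 2) := by gcongr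
    _ = _ := by ring

/-! ### Concentrating test functions -/

/-- Scaling: the region contains a ball of radius `ρ` centred at distance `3ρ`, where `|z| ≤ 4ρ`;
its volume is of order `ρ^n` and the kernel is at least of order `ρ^{-n-2s}`. -/
lemma exists_le_lintegral_fracKernel {n : ℕ} {s : ℝ} (hn : 0 < n) (hs0 : 0 < s) (hs1 : s < 1) :
    ∃ c : ℝ, 0 < c ∧ ∀ ρ : ℝ, 0 < ρ → ENNReal.ofReal (c * ρ ^ (-(2 * s))) ≤
      ∫⁻ z in {z : Rn n | 2 * ρ < ‖z‖}, ENNReal.ofReal (fracKernel n s z) := by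
  have hC := fracConst_pos (n := n) hs0 hs1
  have hv0 : 0 < volume (Metric.ball (0 : Rn n) 1) := Metric.measure_ball_pos _ _ one_pos
  have hv1 : volume (Metric.ball (0 : Rn n) 1) ≠ ⊤ := measure_ball_lt_top.ne
  set v := (volume (Metric.ball (0 : Rn n) 1)).toReal with hv
  have hvpos : 0 < v := ENNReal.toReal_pos hv0.ne' hv1
  refine ⟨fracConst n s / 2 * 4 ^ (-((n : ℝ) + 2 * s)) * v, by positivity, fun ρ hρ => ?_⟩
  set e : Rn n := EuclideanSpace.single ⟨0, hn⟩ (3 * ρ) with he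
  have hne : ‖e‖ = 3 * ρ := by
    rw [he, PiLp.norm_single, Real.norm_of_nonneg (by positivity)]
  have hball : ∀ z ∈ Metric.ball e ρ, 2 * ρ < ‖z‖ ∧ ‖z‖ ≤ 4 * ρ := by
    intro z hz
    rw [Metric.mem_ball, dist_eq_norm] at hz
    have h1 := norm_sub_norm_le e z
    have h2 := norm_sub_norm_le z e
    rw [norm_sub_rev] at h1
    constructor <;> linarith
  calc ENNReal.ofReal (fracConst n s / 2 * 4 ^ (-((n : ℝ) + 2 * s)) * v * ρ ^ (-(2 * s)))
      = ENNReal.ofReal (fracConst n s / 2 * (4 * ρ) ^ (-((n : ℝ) + 2 * s))) *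
          volume (Metric.ball e ρ) := by
        rw [Measure.addHaar_ball_of_pos volume e hρ, finrank_euclideanSpace_fin,
          ← ENNReal.ofReal_toReal hv1, ← hv, ← ENNReal.ofReal_mul (by positivity),
          ← ENNReal.ofReal_mul (by positivity)]
        congr 1
        rw [Real.mul_rpow (by norm_num) hρ.le]
        have : ρ ^ (-(2 * s)) = ρ ^ (-((n : ℝ) + 2 * s)) * ρ ^ n := by
          rw [← Real.rpow_natCast, ← Real.rpow_add hρ]
          congr 1
          ring
        rw [this]
        ring
    _ = ∫⁻ _ in Metric.ball e ρ,
          ENNReal.ofReal (fracConst n s / 2 * (4 * ρ) ^ (-((n : ℝ) + 2 * s))) := by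
        rw [setLIntegral_const]
    _ ≤ ∫⁻ z in Metric.ball e ρ, ENNReal.ofReal (fracKernel n s z) := by
        refine setLIntegral_mono' measurableSet_ball fun z hz => ENNReal.ofReal_le_ofReal ?_
        obtain ⟨h1, h2⟩ := hball z hz
        refine mul_le_mul_of_nonneg_left ?_ (by positivity)
        exact Real.rpow_le_rpow_of_nonpos (by linarith) h2 (by
          have : (0 : ℝ) ≤ (n : ℝ) + 2 * s := by positivity
          linarith)
    _ ≤ _ := lintegral_mono_set fun z hz => (hball z hz).1

/-- There are test functions concentrated near a point whose `L²` norm is small compared to the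
Gagliardo seminorm. -/
lemma exists_concentrated {n : ℕ} {s : ℝ} (hn : 0 < n) (hs0 : 0 < s) (hs1 : s < 1) (x₀ : Rn n)
    {r η : ℝ} (hr : 0 < r) (hη : 0 < η) :
    ∃ φ : Hs n s, (∀ᵐ x, x ∉ Metric.ball x₀ r → (φ : Rn n → ℝ) x = 0) ∧
      0 < ‖Hs.grad n hs0 hs1 φ‖ ∧
      ‖Hs.toL2 n s φ‖ ^ 2 ≤ η * ‖Hs.grad n hs0 hs1 φ‖ ^ 2 := by
  obtain ⟨c, hc, hk⟩ := exists_le_lintegral_fracKernel (n := n) hn hs0 hs1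
  -- The Poincaré constant of a ball of radius `ρ` blows up as `ρ → 0`, so some `ρ < r` makes it at
  -- least `η⁻¹`.
  have hlim : Filter.Tendsto (fun ρ : ℝ => c * ρ ^ (-(2 * s))) (nhdsWithin 0 (Ioi 0))
      Filter.atTop :=
    (tendsto_rpow_neg_nhdsGT_zero (by linarith)).const_mul_atTop hc
  obtain ⟨ρ, ⟨hρη, hρr⟩, hρ⟩ := ((hlim.eventually_ge_atTop η⁻¹).and
    (nhdsWithin_le_nhds (Iio_mem_nhds hr))).and self_mem_nhdsWithin |>.exists
  have hρ0 : 0 < ρ := hρ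
  let b : ContDiffBump x₀ := ⟨ρ / 2, ρ, by positivity, by linarith⟩
  obtain ⟨φ, hφ⟩ := Hs.exists_eq_of_contDiff s b.contDiff b.hasCompactSupport
  have hsupp : ∀ᵐ x, x ∉ Metric.ball x₀ ρ → (φ : Rn n → ℝ) x = 0 := by
    filter_upwards [hφ] with x hx hxb
    rw [hx]
    have := b.support_eq
    by_contra h
    exact hxb (this ▸ h)
  have hS : MeasurableSet {z : Rn n | 2 * ρ < ‖z‖} :=
    measurableSet_lt measurable_const measurable_norm
  have hP := Hs.poincare hs0 hs1 φ hS hsupp (fun z hz x hx hxz => by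
    rw [Metric.mem_ball, dist_eq_norm] at hx hxz
    have h1 : 2 * ρ < ‖z‖ := hz
    have h2 := norm_sub_le (x + z - x₀) (x - x₀)
    rw [sub_sub_sub_cancel_right, add_sub_cancel_left] at h2
    linarith)
  have hP' := (mul_le_mul_left ((ENNReal.ofReal_le_ofReal hρη).trans (hk ρ hρ0)) _).trans hP
  rw [← ofReal_norm, ← ofReal_norm, ← ENNReal.ofReal_pow (norm_nonneg _),
    ← ENNReal.ofReal_pow (norm_nonneg _), ← ENNReal.ofReal_mul (by positivity),
    ENNReal.ofReal_le_ofReal_iff (by positivity)] at hP'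
  have hle : ‖Hs.toL2 n s φ‖ ^ 2 ≤ η * ‖Hs.grad n hs0 hs1 φ‖ ^ 2 := by
    rwa [inv_mul_le_iff₀ hη] at hP'
  have hne : Hs.toL2 n s φ ≠ 0 := by
    intro h0
    have h1 : (b : Rn n → ℝ) =ᵐ[volume] 0 := by
      refine hφ.symm.trans ?_
      rw [h0]
      exact Lp.coeFn_zero _ _ _
    have h2 := (Continuous.ae_eq_iff_eq volume b.continuous continuous_zero).1 h1
    have h3 : b x₀ = 1 := b.one_of_mem_closedBall (Metric.mem_closedBall_self b.rIn_pos.le)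
    rw [h2] at h3
    simp at h3
  refine ⟨φ, hsupp.mono fun x h hx => h fun hx' => hx (Metric.ball_subset_ball hρr.le hx'), ?_,
    hle⟩
  have h1 : 0 < ‖Hs.toL2 n s φ‖ := norm_pos_iff.2 hne
  refine (norm_nonneg _).lt_of_ne' fun h => ?_
  rw [h] at hle
  nlinarith

/-! ### Recovery of the conductivity at a point -/

/-- Near a point of continuity of the conductivity, the Dirichlet-to-Neumann map determines its
value. -/
lemma exists_abs_dnMap_sub_mul_le {n : ℕ} {s : ℝ} (hs0 : 0 < s) (hs1 : s < 1) {Ω W : Set (Rn n)}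
    (hW : IsOpen W) (hWΩ : W ⊆ (closure Ω)ᶜ) {γ : Rn n → ℝ} {γ₀ : ℝ} (hγ₀ : 0 < γ₀)
    (hγ : MemLp γ ∞ volume) (hpos : ∀ᵐ x, γ₀ ≤ γ x) (hcont : ContinuousOn γ W)
    {Λ : ExteriorSpace s Ω →L[ℝ] (ExteriorSpace s Ω →L[ℝ] ℝ)} (hΛ : IsDNMap Ω γ Λ)
    {x₀ : Rn n} (hx₀ : x₀ ∈ W) (hx₀pos : γ₀ ≤ γ x₀) {ε : ℝ} (hε : 0 < ε) :
    ∃ r C : ℝ, 0 < r ∧ ∀ φ : Hs n s,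
      (∀ᵐ x, x ∉ Metric.ball x₀ r → (φ : Rn n → ℝ) x = 0) →
      |Λ (exteriorMk s Ω φ) (exteriorMk s Ω φ) - γ x₀ * ‖Hs.grad n hs0 hs1 φ‖ ^ 2| ≤
        ε * ‖Hs.grad n hs0 hs1 φ‖ ^ 2 + C * ‖Hs.toL2 n s φ‖ ^ 2 := by
  have hcx : ContinuousAt (fun x => √(γ x)) x₀ :=
    (hcont.continuousAt (hW.mem_nhds hx₀)).sqrt
  have hlim : Filter.Tendsto (fun p : Rn n × Rn n => √(γ p.1) * √(γ p.2))
      (nhds x₀ ×ˢ nhds x₀) (nhds (γ x₀)) := by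
    have := (hcx.tendsto.comp Filter.tendsto_fst).mul
      (hcx.tendsto.comp (Filter.tendsto_snd (f := nhds x₀)))
    rwa [Real.mul_self_sqrt (hγ₀.le.trans hx₀pos)] at this
  have hev : ∀ᶠ p in nhds x₀ ×ˢ nhds x₀,
      (fun x y => |√(γ x) * √(γ y) - γ x₀| ≤ ε) p.1 p.2 :=
    hlim.eventually (Metric.closedBall_mem_nhds _ hε)
  obtain ⟨U, hU, hUε⟩ := (Filter.eventually_prod_self_iff
    (r := fun x y => |√(γ x) * √(γ y) - γ x₀| ≤ ε)).1 hev
  obtain ⟨R, hR, hRU⟩ := Metric.mem_nhds_iff.1 (Filter.inter_mem hU (hW.mem_nhds hx₀))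
  -- Halving `R` serves twice: the double ball is the ball of radius `R`, and the small ball keeps
  -- distance `R / 2` from `Ω`.
  have hRR : 2 * (R / 2) = R := by ring
  have hr : 0 < R / 2 := by positivity
  have hclose : ∀ x ∈ Metric.ball x₀ (2 * (R / 2)), ∀ y ∈ Metric.ball x₀ (2 * (R / 2)),
      |√(γ x) * √(γ y) - γ x₀| ≤ ε := by
    rw [hRR]
    intro x hx y hy
    exact hUε x (hRU hx).1 y (hRU hy).1
  have hdist : ∀ x ∈ Metric.ball x₀ (R / 2), ∀ y ∈ Ω, R / 2 ≤ ‖x - y‖ := by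
    intro x hx y hy
    by_contra! h
    have hy' : y ∈ Metric.ball x₀ R := by
      rw [Metric.mem_ball] at hx ⊢
      have := dist_triangle_left y x₀ x
      rw [dist_eq_norm x y] at this
      linarith
    exact hWΩ (hRU hy').2 (subset_closure hy)
  obtain ⟨C₁, h₁⟩ := exists_abs_dnMap_sub_le hs0 hs1 hγ₀ hγ hpos hΛ hr hdist
  obtain ⟨C₂, h₂⟩ := exists_abs_conductivityForm_sub_le hs0 hs1 hγ hr hε.le hclose
  refine ⟨R / 2, C₁ + C₂, hr, fun φ hφ => ?_⟩
  have := abs_sub_le (Λ (exteriorMk s Ω φ) (exteriorMk s Ω φ)) (conductivityForm hs0 hs1 hγ φ φ)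
    (γ x₀ * ‖Hs.grad n hs0 hs1 φ‖ ^ 2)
  have := h₁ φ hφ
  have := h₂ φ hφ
  linarith

lemma norm_exteriorMk_le {n : ℕ} {s : ℝ} (Ω : Set (Rn n)) (u : Hs n s) :
    ‖exteriorMk s Ω u‖ ≤ ‖u‖ :=
  Submodule.Quotient.norm_mk_le (HsTilde s Ω) u

lemma abs_sub_le_norm_sub {n : ℕ} {s : ℝ} (hn : 0 < n) (hs0 : 0 < s) (hs1 : s < 1)
    {Ω W : Set (Rn n)} (hW : IsOpen W) (hWΩ : W ⊆ (closure Ω)ᶜ) {γ₁ γ₂ : Rn n → ℝ} {γ₀ : ℝ}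
    (hγ₀ : 0 < γ₀) (hγ₁ : MemLp γ₁ ∞ volume) (hγ₂ : MemLp γ₂ ∞ volume)
    (hpos₁ : ∀ᵐ x, γ₀ ≤ γ₁ x) (hpos₂ : ∀ᵐ x, γ₀ ≤ γ₂ x)
    (hcont₁ : ContinuousOn γ₁ W) (hcont₂ : ContinuousOn γ₂ W)
    {Λ₁ Λ₂ : ExteriorSpace s Ω →L[ℝ] (ExteriorSpace s Ω →L[ℝ] ℝ)}
    (hΛ₁ : IsDNMap Ω γ₁ Λ₁) (hΛ₂ : IsDNMap Ω γ₂ Λ₂)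
    {x₀ : Rn n} (hx₀ : x₀ ∈ W) (hx₁ : γ₀ ≤ γ₁ x₀) (hx₂ : γ₀ ≤ γ₂ x₀) :
    |γ₁ x₀ - γ₂ x₀| ≤ ‖Λ₁ - Λ₂‖ := by
  refine le_of_forall_pos_le_add fun ε hε => ?_
  have hε3 : 0 < ε / 3 := by positivity
  obtain ⟨r₁, C₁, hr₁, h₁⟩ :=
    exists_abs_dnMap_sub_mul_le hs0 hs1 hW hWΩ hγ₀ hγ₁ hpos₁ hcont₁ hΛ₁ hx₀ hx₁ hε3
  obtain ⟨r₂, C₂, hr₂, h₂⟩ :=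
    exists_abs_dnMap_sub_mul_le hs0 hs1 hW hWΩ hγ₀ hγ₂ hpos₂ hcont₂ hΛ₂ hx₀ hx₂ hε3
  -- `K` collects the coefficients of all `L²` errors: `N` from the `H^s` norm of `φ`, and `C₁`,
  -- `C₂` from the two energy comparisons. Taking `η = ε / 3 / (K + 1)` below makes their sum at
  -- most a third of `ε` times the squared seminorm.
  set N := ‖Λ₁ - Λ₂‖ with hN
  have hN0 : 0 ≤ N := norm_nonneg (Λ₁ - Λ₂)
  set K := N + |C₁| + |C₂| with hK
  have hK0 : 0 ≤ K := by positivity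
  obtain ⟨φ, hφ, hφ0, hφη⟩ := exists_concentrated hn hs0 hs1 x₀ (lt_min hr₁ hr₂)
    (show 0 < ε / 3 / (K + 1) by positivity)
  have e₁ := h₁ φ (hφ.mono fun x h hx =>
    h fun hx' => hx (Metric.ball_subset_ball (min_le_left _ _) hx'))
  have e₂ := h₂ φ (hφ.mono fun x h hx =>
    h fun hx' => hx (Metric.ball_subset_ball (min_le_right _ _) hx'))
  have e₃ : |Λ₁ (exteriorMk s Ω φ) (exteriorMk s Ω φ) -
      Λ₂ (exteriorMk s Ω φ) (exteriorMk s Ω φ)| ≤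
      N * (‖Hs.toL2 n s φ‖ ^ 2 + ‖Hs.grad n hs0 hs1 φ‖ ^ 2) := by
    have h := (Λ₁ - Λ₂).le_opNorm₂ (exteriorMk s Ω φ) (exteriorMk s Ω φ)
    rw [sub_apply, sub_apply, Real.norm_eq_abs, mul_assoc, ← sq] at h
    refine h.trans (mul_le_mul_of_nonneg_left ?_ hN0)
    refine le_trans ?_ (Hs.norm_sq_le hs0 hs1 φ)
    exact pow_le_pow_left₀ (norm_nonneg _) (norm_exteriorMk_le Ω φ) 2
  have hL0 : 0 ≤ ‖Hs.toL2 n s φ‖ ^ 2 := by positivity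
  generalize ‖Hs.grad n hs0 hs1 φ‖ = D at *
  generalize ‖Hs.toL2 n s φ‖ ^ 2 = L at *
  generalize Λ₁ (exteriorMk s Ω φ) (exteriorMk s Ω φ) = a₁ at *
  generalize Λ₂ (exteriorMk s Ω φ) (exteriorMk s Ω φ) = a₂ at *
  have hD : 0 < D ^ 2 := by positivity
  have e₄ : K * L ≤ ε / 3 * D ^ 2 := by
    have hL := mul_le_mul_of_nonneg_left hφη hK0
    refine hL.trans ?_
    rw [← mul_assoc]
    refine mul_le_mul_of_nonneg_right ?_ hD.le
    rw [mul_div_assoc', div_le_iff₀ (by positivity)]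
    nlinarith
  have hL1 : C₁ * L ≤ |C₁| * L := mul_le_mul_of_nonneg_right (le_abs_self _) hL0
  have hL2 : C₂ * L ≤ |C₂| * L := mul_le_mul_of_nonneg_right (le_abs_self _) hL0
  have e₅ : |γ₁ x₀ - γ₂ x₀| * D ^ 2 ≤
      |a₁ - a₂| + |a₁ - γ₁ x₀ * D ^ 2| + |a₂ - γ₂ x₀ * D ^ 2| := by
    rw [← abs_of_pos hD, ← abs_mul, abs_of_pos hD]
    have e : (γ₁ x₀ - γ₂ x₀) * D ^ 2 =
        (a₁ - a₂) - (a₁ - γ₁ x₀ * D ^ 2) + (a₂ - γ₂ x₀ * D ^ 2) := by ring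
    rw [e]
    exact (abs_add_le _ _).trans (add_le_add_left (abs_sub _ _) _)
  have e₆ : K * L = N * L + |C₁| * L + |C₂| * L := by rw [hK]; ring
  refine le_of_mul_le_mul_right ?_ hD
  linarith

end FracCond

end

theorem proposition1p4 {n : ℕ} {s : ℝ} (hs0 : 0 < s) (hs1 : s < min 1 ((n : ℝ) / 2))
    {Ω : Set (FracCond.Rn n)} (hΩ : IsOpen Ω) (hΩb : FracCond.BoundedInOneDirection Ω)
    {γ₁ γ₂ : FracCond.Rn n → ℝ} {γ₀ : ℝ} (hγ₀ : 0 < γ₀)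
    (hγ₁ : MemLp γ₁ ∞ volume) (hγ₂ : MemLp γ₂ ∞ volume)
    (hγ₁pos : ∀ᵐ x, γ₀ ≤ γ₁ x) (hγ₂pos : ∀ᵐ x, γ₀ ≤ γ₂ x)
    (hm₁ : FracCond.MemBessel (2 * s) (ENNReal.ofReal ((n : ℝ) / (2 * s))) (fun x => √(γ₁ x) - 1))
    (hm₂ : FracCond.MemBessel (2 * s) (ENNReal.ofReal ((n : ℝ) / (2 * s))) (fun x => √(γ₂ x) - 1))
    {W : Set (FracCond.Rn n)} (hW : IsOpen W) (hWne : W.Nonempty) (hWΩ : W ⊆ (closure Ω)ᶜ)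
    (hcont₁ : ContinuousOn γ₁ W) (hcont₂ : ContinuousOn γ₂ W) :
    FracCond.IsDNMap Ω γ₁ (FracCond.dnMap s Ω γ₁) ∧
    FracCond.IsDNMap Ω γ₂ (FracCond.dnMap s Ω γ₂) ∧
    eLpNorm (γ₁ - γ₂) ∞ (volume.restrict W) ≤
      ENNReal.ofReal ((2 : ℝ) ^ s * ‖FracCond.dnMap s Ω γ₁ - FracCond.dnMap s Ω γ₂‖) := by
  have h1 : s < 1 := hs1.trans_le (min_le_left _ _)
  have hn : 0 < n := by
    have := hs0.trans (hs1.trans_le (min_le_right _ _))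
    have : (0 : ℝ) < n := by linarith
    exact_mod_cast this
  have hΛ₁ := FracCond.isDNMap_dnMap hs0 h1 hΩb hγ₀ hγ₁ hγ₁pos
  have hΛ₂ := FracCond.isDNMap_dnMap hs0 h1 hΩb hγ₀ hγ₂ hγ₂pos
  refine ⟨hΛ₁, hΛ₂, ?_⟩
  rw [eLpNorm_exponent_top]
  refine essSup_le_of_ae_le _ ?_
  -- The lower bounds hold only almost everywhere; the pointwise estimate is used at those points of
  -- `W` where both hold.
  filter_upwards [ae_restrict_of_ae hγ₁pos, ae_restrict_of_ae hγ₂pos,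
    ae_restrict_mem hW.measurableSet] with x hx₁ hx₂ hxW
  have h := FracCond.abs_sub_le_norm_sub hn hs0 h1 hW hWΩ hγ₀ hγ₁ hγ₂ hγ₁pos hγ₂pos hcont₁ hcont₂
    hΛ₁ hΛ₂ hxW hx₁ hx₂
  rw [Pi.sub_apply, ← ofReal_norm, Real.norm_eq_abs]
  refine ENNReal.ofReal_le_ofReal (h.trans (le_mul_of_one_le_left (norm_nonneg
    (FracCond.dnMap s Ω γ₁ - FracCond.dnMap s Ω γ₂)) ?_))
  exact Real.one_le_rpow one_le_two hs0.le
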